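/- Let $d\ge 1$, $\alpha\in(0,2]$, $p>1$. For a measurable $u_0\ge 0$ on $\mathbb{R}^d$ consider nonnegative solutions of the Cauchy problem $$u_t=-(-\Delta)^{\alpha/2}u+u^p,\qquad u(\cdot,0)=u_0. \qquad (*)$$ Here $e^{-t(-\Delta)^{\alpha/2}}$ denotes convolution with $P_{t,\alpha}(x)=\int_{\mathbb{R}^d}e^{-t|2\pi\xi|^\alpha}e^{2\pi i x\cdot\xi}\,d\xi$. A (mild) solution on $[0,T)$, $0<T\le\infty$, is a measurable function $u$, finite and nonnegative on $(0,T)\times\mathbb{R}^d$, such that for every $t\in(0,T)$ $$u(\cdot,t)=e^{-t(-\Delta)^{\alpha/2}}u_0+\int_0^t e^{-(t-s)(-\Delta)^{\alpha/2}}u(\cdot,s)^p\,ds\quad\text{a.e. on }\mathbb{R}^d;$$ it is maximal if no solution on a longer interval $[0,T')$ coincides with it (a.e. in $x$, for each $t$) on $(0,T)$. "Each solution blows up in a finite time" means that every maximal solution has $T<\infty$ and $\limsup_{t\nearrow T}\|u(\cdot,t)\|_{L^\infty(\mathbb{R}^d)}=\infty$ (so there is no global solution). Put $\sigma_d=\dfrac{2\pi^{d/2}}{\Gamma(d/2)}$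 and define the radial concentration $$|\!|\!|u_0|\!|\!|_{\frac{d(p-1)}{\alpha}}=\sup_{r>0}r^{\frac{\alpha}{p-1}-d}\int_{\{|y|<r\}}u_0(y)\,dy\in[0,\infty].$$ For $d>\alpha$ and $p>1+\frac{\alpha}{d-\alpha}$ let $u_\infty(x)=s(\alpha,d,p)|x|^{-\frac{\alpha}{p-1}}$ be the singular stationary solution, where $$s(\alpha,d,p)=\left(\frac{2^\alpha}{\Gamma\left(\frac{\alpha}{2(p-1)}\right)}\,\frac{\Gamma\left(\frac d2-\frac{\alpha}{2(p-1)}\right)\Gamma\left(\frac{p\alpha}{2(p-1)}\right)}{\Gamma\left(\frac d2-\frac{p\alpha}{2(p-1)}\right)}\right)^{\frac1{p-1}}.$$ **Theorem.** (i) For each $\alpha\in(0,2]$ and $p>1$ there is a constant $\nu_{\alpha,p}$, independent of $d$, such that for every $d>\alpha$ with $p>1+\frac{\alpha}{d-\alpha}$ and every $N>\nu_{\alpha,p}$: if $u_0\ge N u_\infty$ a.e. on $\mathbb{R}^d$, then each solution of $(*)$ blows up in a finite time. (ii) Let $\alpha=2$. For each $p>1$ there is a constant $\kappa_{2,p}$,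 independent of $d$, such that for every $d\ge1$ with $p>1+\frac2d$: if $$|\!|\!|u_0|\!|\!|_{\frac{d(p-1)}{2}}\ge\kappa\,\sigma_d\,d^{\frac1{p-1}-\frac12}\quad\text{for some }\kappa>\kappa_{2,p},$$ then each solution of $(*)$ blows up in a finite time. (iii) For each $\alpha\in(0,2)$ and $p>1$ there is a constant $\kappa_{\alpha,p}$, independent of $d$, such that for every $d\ge1$ with $p>1+\frac\alpha d$: if $$|\!|\!|u_0|\!|\!|_{\frac{d(p-1)}{\alpha}}\ge\kappa\,\sigma_d\,d^{\frac{\alpha}{2(p-1)}}\quad\text{for some }\kappa>\kappa_{\alpha,p},$$ then each solution of $(*)$ blows up in a finite time. -/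

import Mathlib

open MeasureTheory Filter Topology
open scoped ENNReal FourierTransform

/-- The convolution kernel of the semigroup `exp (-t (-Δ)^(α/2))` on `ℝ^d`: the inverse Fourier
transform of the multiplier `ξ ↦ exp (-t |2πξ|^α)` (Fourier transform with kernel
`exp (-2πi x·ξ)`, for which the symbol of `-Δ` is `|2πξ|²`).  For `0 < α ≤ 2` and `t > 0` it is
real and nonnegative; for `α = 2` it is the Gauss-Weierstrass kernel. -/
noncomputable def fracHeatKernel {d : ℕ} (α t : ℝ) (x : EuclideanSpace ℝ (Fin d)) : ℝ :=
  (𝓕⁻ (fun ξ : EuclideanSpace ℝ (Fin d) =>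
    ((Real.exp (-t * (2 * Real.pi * ‖ξ‖) ^ α) : ℝ) : ℂ)) x).re

/-- `(exp (-t (-Δ)^(α/2)) f)(x)` for a nonnegative measurable function `f`, as an element of
`[0, ∞]`. -/
noncomputable def fracHeat {d : ℕ} (α t : ℝ) (f : EuclideanSpace ℝ (Fin d) → ℝ)
    (x : EuclideanSpace ℝ (Fin d)) : ℝ≥0∞ :=
  ∫⁻ y, ENNReal.ofReal (fracHeatKernel α t (x - y)) * ENNReal.ofReal (f y)

/-- `u` is a nonnegative (mild) solution on the time interval `[0, T)`, `0 < T ≤ ∞`, of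
`u_t = -(-Δ)^(α/2) u + u^p`, `u(0) = u₀`: it is measurable and finite, and
`u(t) = exp (-t (-Δ)^(α/2)) u₀ + ∫₀ᵗ exp (-(t-s) (-Δ)^(α/2)) u(s)^p ds` almost everywhere on
`ℝ^d`, for every `t` in `(0, T)`.  No boundedness or growth condition is imposed. -/
structure IsSolution {d : ℕ} (α p : ℝ) (u₀ : EuclideanSpace ℝ (Fin d) → ℝ) (T : ℝ≥0∞)
    (u : ℝ → EuclideanSpace ℝ (Fin d) → ℝ) : Prop where
  pos : 0 < T
  measurable : Measurable (fun z : ℝ × EuclideanSpace ℝ (Fin d) => u z.1 z.2)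
  nonneg : ∀ t : ℝ, 0 < t → ENNReal.ofReal t < T → ∀ x, 0 ≤ u t x
  duhamel : ∀ t : ℝ, 0 < t → ENNReal.ofReal t < T → ∀ᵐ x,
    ENNReal.ofReal (u t x) = fracHeat α t u₀ x +
      ∫⁻ s in Set.Ioo 0 t, fracHeat α (t - s) (fun y => u s y ^ p) x

/-- A solution on `[0, T)` that cannot be continued, as a solution, to any `[0, T')` with
`T' > T`.  A global solution (`T = ∞`) is maximal. -/
def IsMaximalSolution {d : ℕ} (α p : ℝ) (u₀ : EuclideanSpace ℝ (Fin d) → ℝ) (T : ℝ≥0∞)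
    (u : ℝ → EuclideanSpace ℝ (Fin d) → ℝ) : Prop :=
  IsSolution α p u₀ T u ∧
    ∀ (T' : ℝ≥0∞) (v : ℝ → EuclideanSpace ℝ (Fin d) → ℝ), T < T' → IsSolution α p u₀ T' v →
      ¬ ∀ t : ℝ, 0 < t → ENNReal.ofReal t < T → v t =ᵐ[volume] u t

/-- Each solution with initial datum `u₀` blows up in a finite time: its maximal existence time
`T` is finite and `limsup_{t ↗ T} ‖u(t)‖_∞ = ∞`.  In particular there is no global solution. -/
def EachSolutionBlowsUp {d : ℕ} (α p : ℝ) (u₀ : EuclideanSpace ℝ (Fin d) → ℝ) : Prop :=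
  ∀ (T : ℝ≥0∞) (u : ℝ → EuclideanSpace ℝ (Fin d) → ℝ), IsMaximalSolution α p u₀ T u →
    T < ∞ ∧ limsup (fun t => eLpNorm (u t) ∞ volume) (𝓝[<] T.toReal) = ∞

/-- The area `σ_d = 2 π^(d/2) / Γ(d/2)` of the unit sphere of `ℝ^d`. -/
noncomputable def sphereArea (d : ℕ) : ℝ :=
  2 * Real.pi ^ ((d : ℝ) / 2) / Real.Gamma ((d : ℝ) / 2)

/-- The constant `s(α, d, p)` of the singular stationary solution. -/
noncomputable def singularConst (α : ℝ) (d : ℕ) (p : ℝ) : ℝ :=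
  (2 ^ α / Real.Gamma (α / (2 * (p - 1))) *
    (Real.Gamma ((d : ℝ) / 2 - α / (2 * (p - 1))) * Real.Gamma (p * α / (2 * (p - 1))) /
      Real.Gamma ((d : ℝ) / 2 - p * α / (2 * (p - 1))))) ^ (1 / (p - 1))

/-- The singular stationary solution `u_∞(x) = s(α, d, p) |x|^(-α/(p-1))` (for `x ≠ 0`), which
exists for `p > 1 + α/(d - α)`, `d > α`. -/
noncomputable def singularSol (α : ℝ) {d : ℕ} (p : ℝ) (x : EuclideanSpace ℝ (Fin d)) : ℝ :=
  singularConst α d p * ‖x‖ ^ (-(α / (p - 1)))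

/-- The `d(p-1)/α`-radial concentration `sup_{r > 0} r^(α/(p-1) - d) ∫_{|y| < r} u₀(y) dy` of
`u₀ ≥ 0`, as an element of `[0, ∞]`. -/
noncomputable def radialConcentration {d : ℕ} (α p : ℝ) (u₀ : EuclideanSpace ℝ (Fin d) → ℝ) :
    ℝ≥0∞ :=
  ⨆ (r : ℝ) (_ : 0 < r), ENNReal.ofReal (r ^ (α / (p - 1) - (d : ℝ))) *
    ∫⁻ y in Metric.ball 0 r, ENNReal.ofReal (u₀ y)

/-! Fix a solution, a time τ inside its interval and a point x, and let V(s) be the semigroup at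
time τ - s applied to u(s), evaluated at x. Duhamel's formula and the semigroup law give V(s) = A +
∫₀ˢ g, where A is the linear evolution of the datum at time τ and g is the propagated forcing
(`IsSolution.heatE_sub`). The kernel has mass at most one, so Jensen's inequality gives V^p ≤ g.
Since V stays finite up to τ, superlinearity forces A ≤ K τ^(-1/(p-1)) with K depending on p only
(`mul_le_one_of_superlinear`, `IsSolution.fracHeat_le`). A datum violating this bound at one τ at
the origin has no global solution. Moreover, a solution bounded near a finite T can be continued by
monotone iteration (`IsSolution.exists_extension`), so a maximal one is unbounded there.

It remains to bound the linear evolution at the origin from below, with the right power of d. Write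
γ = α/(p-1).

For (i), half of the kernel mass at time one lies in a ball of radius C√d
(`exists_half_le_integral_ball`). There u_∞ is at least s(α,d,p)(C√d)^(-γ), and s(α,d,p) ≥ c d^(γ/2)
by a Gamma quotient estimate, so the powers of d cancel.

For (ii) and (iii), radial monotonicity gives P_τ(x) ∫_{|y|<|x|} u₀ ≤ K τ^(-1/(p-1)) whenever the a
priori bound holds. For general α, scaling and integration over τ turn the kernel into its mass in
the ball of radius C√d, at the cost d^(γ/2). For α = 2, the single best τ and Stirling's formula
save a further √d.

Positivity and monotonicity of the kernel are reduced to the Gaussian case by subordination, used in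
dual form: a function nonnegative against all Gaussians is nonnegative against the symbol. -/

/-! ### Subordination: from exponentials to exponentials of fractional powers. -/

/-- The functional `φ ↦ ∫ exp (-δ ρ) φ(ρ) h` is nonnegative for each `δ > 0`. -/
def LaplaceNonneg {X : Type*} [MeasurableSpace X] (μ : Measure X) (ρ h : X → ℝ) (φ : ℝ → ℝ) :
    Prop :=
  ∀ δ : ℝ, 0 < δ → 0 ≤ ∫ x, Real.exp (-δ * ρ x) * φ (ρ x) * h x ∂μ

namespace LaplaceNonneg

variable {X : Type*} [MeasurableSpace X] {μ : Measure X} {ρ h : X → ℝ}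

theorem integrable_exp_neg_mul_mul {φ : ℝ → ℝ} {B C δ : ℝ} (hρ : Measurable ρ) (hρ0 : ∀ x, 0 ≤ ρ x)
    (hh : Measurable h) (hB : ∀ x, |h x| ≤ B) (hφ : Measurable φ) (hC : ∀ r, 0 ≤ r → |φ r| ≤ C)
    (hint : Integrable (fun x => Real.exp (-δ * ρ x)) μ) :
    Integrable (fun x => Real.exp (-δ * ρ x) * φ (ρ x) * h x) μ := by
  refine (hint.mul_const (C * B)).mono' (by fun_prop) (ae_of_all _ fun x => ?_)
  rw [norm_mul, norm_mul, Real.norm_eq_abs, Real.norm_eq_abs, Real.norm_eq_abs, Real.abs_exp,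
    mul_assoc]
  exact mul_le_mul_of_nonneg_left
    (mul_le_mul (hC _ (hρ0 x)) (hB x) (abs_nonneg _) ((abs_nonneg _).trans (hC _ (hρ0 x))))
    (Real.exp_pos _).le

/-- By Fubini the new functional at δ is an average, with weight k(s), of the old one at δ + s. This
is why nonnegativity is required for every δ > 0 at once. -/
theorem mul_laplace [SFinite μ] {φ : ℝ → ℝ} {B C ε : ℝ} (hA : LaplaceNonneg μ ρ h φ)
    (hρ : Measurable ρ) (hρ0 : ∀ x, 0 ≤ ρ x)
    (hh : Measurable h) (hB : ∀ x, |h x| ≤ B) (hφ : Measurable φ) (hC : ∀ r, 0 ≤ r → |φ r| ≤ C)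
    (hint : ∀ δ : ℝ, 0 < δ → Integrable (fun x => Real.exp (-δ * ρ x)) μ)
    (hε : 0 ≤ ε) {k : ℝ → ℝ} (hk : IntegrableOn k (Set.Ioi ε)) (hk0 : ∀ s, ε < s → 0 ≤ k s) :
    LaplaceNonneg μ ρ h (fun r => φ r * ∫ s in Set.Ioi ε, Real.exp (-s * r) * k s) := by
  intro δ hδ
  have h1 : ∀ x, Real.exp (-δ * ρ x) * (φ (ρ x) * ∫ s in Set.Ioi ε, Real.exp (-s * ρ x) * k s) * h x
      = ∫ s in Set.Ioi ε, k s * (Real.exp (-(δ + s) * ρ x) * φ (ρ x) * h x) := by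
    intro x
    rw [show Real.exp (-δ * ρ x) * (φ (ρ x) * ∫ s in Set.Ioi ε, Real.exp (-s * ρ x) * k s) * h x
      = (Real.exp (-δ * ρ x) * φ (ρ x) * h x) * ∫ s in Set.Ioi ε, Real.exp (-s * ρ x) * k s by ring,
      ← integral_const_mul]
    congr 1; ext s
    rw [show -(δ + s) * ρ x = -δ * ρ x + -s * ρ x by ring, Real.exp_add]; ring
  simp_rw [h1]
  rw [integral_integral_swap]
  · refine setIntegral_nonneg measurableSet_Ioi fun s hs => ?_
    rw [integral_const_mul]
    exact mul_nonneg (hk0 s hs) (hA (δ + s) (by have := Set.mem_Ioi.1 hs; linarith))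
  · have hb := ((integrable_exp_neg_mul_mul hρ hρ0 hh hB hφ hC (hint δ hδ))).mul_prod hk
    refine hb.mono ?_ ?_
    · have hk' := hk.aestronglyMeasurable.comp_snd (μ := μ)
      refine AEStronglyMeasurable.mul hk' (Measurable.aestronglyMeasurable ?_)
      fun_prop
    · have : ∀ᵐ z ∂(μ.prod (volume.restrict (Set.Ioi ε))), ε < z.2 :=
        Measure.quasiMeasurePreserving_snd.ae (ae_restrict_mem measurableSet_Ioi)
      filter_upwards [this] with z hz
      simp only [Function.uncurry, norm_mul, Real.norm_eq_abs, Real.abs_exp]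
      rw [mul_comm]
      have h3 : Real.exp (-(δ + z.2) * ρ z.1) ≤ Real.exp (-δ * ρ z.1) := by
        apply Real.exp_le_exp.2
        nlinarith [hρ0 z.1]
      gcongr

theorem const_mul {φ : ℝ → ℝ} (hA : LaplaceNonneg μ ρ h φ) {c : ℝ} (hc : 0 ≤ c) :
    LaplaceNonneg μ ρ h (fun r => c * φ r) := by
  intro δ hδ
  have : ∀ x, Real.exp (-δ * ρ x) * (c * φ (ρ x)) * h x
      = c * (Real.exp (-δ * ρ x) * φ (ρ x) * h x) := fun x => by ring
  simp_rw [this, integral_const_mul]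
  exact mul_nonneg hc (hA δ hδ)

theorem of_tendsto {φ : ℕ → ℝ → ℝ} {ψ : ℝ → ℝ} {B C : ℝ} (hA : ∀ n, LaplaceNonneg μ ρ h (φ n))
    (hρ : Measurable ρ) (hρ0 : ∀ x, 0 ≤ ρ x)
    (hh : Measurable h) (hB : ∀ x, |h x| ≤ B) (hφ : ∀ n, Measurable (φ n))
    (hC : ∀ n r, 0 ≤ r → |φ n r| ≤ C)
    (hint : ∀ δ : ℝ, 0 < δ → Integrable (fun x => Real.exp (-δ * ρ x)) μ)
    (hlim : ∀ r, 0 ≤ r → Tendsto (fun n => φ n r) atTop (𝓝 (ψ r))) :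
    LaplaceNonneg μ ρ h ψ := by
  intro δ hδ
  refine ge_of_tendsto' (f := fun n => ∫ x, Real.exp (-δ * ρ x) * φ n (ρ x) * h x ∂μ)
    (x := atTop) ?_ (fun n => hA n δ hδ)
  refine tendsto_integral_of_dominated_convergence
    (fun x => Real.exp (-δ * ρ x) * (C * B)) (fun n => ?_) ((hint δ hδ).mul_const _)
    (fun n => ae_of_all _ fun x => ?_) (ae_of_all _ fun x => ?_)
  · exact (integrable_exp_neg_mul_mul hρ hρ0 hh hB (hφ n) (hC n) (hint δ hδ)).aestronglyMeasurable
  · rw [norm_mul, norm_mul, Real.norm_eq_abs, Real.norm_eq_abs, Real.norm_eq_abs, Real.abs_exp,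
      mul_assoc]
    exact mul_le_mul_of_nonneg_left (mul_le_mul (hC n _ (hρ0 x)) (hB x) (abs_nonneg _)
      ((abs_nonneg _).trans (hC n _ (hρ0 x)))) (Real.exp_pos _).le
  · exact ((hlim _ (hρ0 x)).const_mul _).mul_const _

theorem add {φ ψ : ℝ → ℝ} {B C D : ℝ} (hA : LaplaceNonneg μ ρ h φ) (hA' : LaplaceNonneg μ ρ h ψ)
    (hρ : Measurable ρ) (hρ0 : ∀ x, 0 ≤ ρ x)
    (hh : Measurable h) (hB : ∀ x, |h x| ≤ B) (hφ : Measurable φ) (hC : ∀ r, 0 ≤ r → |φ r| ≤ C)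
    (hψ : Measurable ψ) (hD : ∀ r, 0 ≤ r → |ψ r| ≤ D)
    (hint : ∀ δ : ℝ, 0 < δ → Integrable (fun x => Real.exp (-δ * ρ x)) μ) :
    LaplaceNonneg μ ρ h (fun r => φ r + ψ r) := by
  intro δ hδ
  have : ∀ x, Real.exp (-δ * ρ x) * (φ (ρ x) + ψ (ρ x)) * h x
      = Real.exp (-δ * ρ x) * φ (ρ x) * h x + Real.exp (-δ * ρ x) * ψ (ρ x) * h x :=
    fun x => by ring
  simp_rw [this]
  rw [integral_add (integrable_exp_neg_mul_mul hρ hρ0 hh hB hφ hC (hint δ hδ))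
    (integrable_exp_neg_mul_mul hρ hρ0 hh hB hψ hD (hint δ hδ))]
  exact add_nonneg (hA δ hδ) (hA' δ hδ)

/-- The exponential of a Laplace transform preserves nonnegativity. -/
theorem exp_laplace [SFinite μ] {B ε : ℝ} (hA : LaplaceNonneg μ ρ h (fun _ => 1))
    (hρ : Measurable ρ) (hρ0 : ∀ x, 0 ≤ ρ x)
    (hh : Measurable h) (hB : ∀ x, |h x| ≤ B)
    (hint : ∀ δ : ℝ, 0 < δ → Integrable (fun x => Real.exp (-δ * ρ x)) μ)
    (hε : 0 ≤ ε) {k : ℝ → ℝ} (hkm : Measurable k) (hk : IntegrableOn k (Set.Ioi ε))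
    (hk0 : ∀ s, ε < s → 0 ≤ k s) :
    LaplaceNonneg μ ρ h (fun r => Real.exp (∫ s in Set.Ioi ε, Real.exp (-s * r) * k s)) := by
  set L : ℝ → ℝ := fun r => ∫ s in Set.Ioi ε, Real.exp (-s * r) * k s with hL
  set K : ℝ := ∫ s in Set.Ioi ε, k s with hK
  have hLm : Measurable L := by
    have : StronglyMeasurable L := by
      refine StronglyMeasurable.integral_prod_right (f := fun r s =>
        Real.exp (-s * r) * k s) (Measurable.stronglyMeasurable ?_)
      simp only [Function.uncurry_def]
      fun_prop
    exact this.measurable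
  have hL0 : ∀ r, 0 ≤ L r := fun r =>
    setIntegral_nonneg measurableSet_Ioi fun s hs => mul_nonneg (Real.exp_pos _).le (hk0 s hs)
  have hLK : ∀ r, 0 ≤ r → L r ≤ K := by
    intro r hr
    refine integral_mono_of_nonneg ?_ hk ?_
    · exact (ae_restrict_mem measurableSet_Ioi).mono fun s hs =>
        mul_nonneg (Real.exp_pos _).le (hk0 s hs)
    · refine (ae_restrict_mem measurableSet_Ioi).mono fun s hs => ?_
      have h0 := hk0 s hs
      have : Real.exp (-s * r) ≤ 1 := Real.exp_le_one_iff.2 (by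
        have := Set.mem_Ioi.1 hs; nlinarith)
      exact mul_le_of_le_one_left h0 this
  -- Repeated use of `mul_laplace` handles the powers of L. The exponential series then gives exp L,
  -- its partial sums being dominated by exp K.
  have hpow : ∀ n : ℕ, LaplaceNonneg μ ρ h (fun r => L r ^ n) := by
    intro n
    induction n with
    | zero => simpa using hA
    | succ n ih =>
      have := ih.mul_laplace hρ hρ0 hh hB (hLm.pow_const n) (C := K ^ n) (fun r hr => by
        rw [abs_of_nonneg (pow_nonneg (hL0 r) n)]
        exact pow_le_pow_left₀ (hL0 r) (hLK r hr) n) hint hε hk hk0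
      simpa only [pow_succ] using this
  have hsm : ∀ N : ℕ, Measurable fun r => ∑ n ∈ Finset.range N, (n.factorial : ℝ)⁻¹ * L r ^ n :=
    fun N => Finset.measurable_sum _ fun n _ => (hLm.pow_const n).const_mul _
  have hsb : ∀ (N : ℕ) (r : ℝ), 0 ≤ r →
      |∑ n ∈ Finset.range N, (n.factorial : ℝ)⁻¹ * L r ^ n| ≤ Real.exp K := by
    intro N r hr
    have h0 : 0 ≤ ∑ n ∈ Finset.range N, (n.factorial : ℝ)⁻¹ * L r ^ n :=
      Finset.sum_nonneg fun n _ => mul_nonneg (by positivity) (pow_nonneg (hL0 r) n)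
    rw [abs_of_nonneg h0]
    refine le_trans ?_ (Real.exp_le_exp.2 (hLK r hr))
    refine le_trans (le_of_eq ?_) (Real.sum_le_exp_of_nonneg (hL0 r) N)
    exact Finset.sum_congr rfl fun n _ => by rw [div_eq_inv_mul]
  have hsum : ∀ N : ℕ, LaplaceNonneg μ ρ h
      (fun r => ∑ n ∈ Finset.range N, (n.factorial : ℝ)⁻¹ * L r ^ n) := by
    intro N
    induction N with
    | zero => intro δ _; simp
    | succ N ih =>
      simp_rw [Finset.sum_range_succ]
      refine ih.add ((hpow N).const_mul (by positivity)) hρ hρ0 hh hB (hsm N) (hsb N)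
        ((hLm.pow_const N).const_mul _) (D := (N.factorial : ℝ)⁻¹ * K ^ N) (fun r hr => ?_) hint
      rw [abs_of_nonneg (mul_nonneg (by positivity) (pow_nonneg (hL0 r) N))]
      exact mul_le_mul_of_nonneg_left (pow_le_pow_left₀ (hL0 r) (hLK r hr) N) (by positivity)
  refine of_tendsto hsum hρ hρ0 hh hB hsm hsb hint fun r _ => ?_
  have := (NormedSpace.expSeries_div_hasSum_exp (L r)).tendsto_sum_nat
  rw [← Real.exp_eq_exp_ℝ] at this
  refine this.congr fun N => Finset.sum_congr rfl fun n _ => by rw [div_eq_inv_mul]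

end LaplaceNonneg

/-- The Lévy integrand of the Bernstein function `r ↦ r ^ β`. -/
theorem integrableOn_one_sub_exp_mul_rpow {β r : ℝ} (h0 : 0 < β) (h1 : β < 1) (hr : 0 ≤ r) :
    IntegrableOn (fun s : ℝ => (1 - Real.exp (-s * r)) * s ^ (-1 - β)) (Set.Ioi 0) := by
  rw [← Set.Ioc_union_Ioi_eq_Ioi (zero_le_one' ℝ)]
  refine IntegrableOn.union ?_ ?_
  · have : IntegrableOn (fun s : ℝ => r * s ^ (-β)) (Set.Ioc 0 1) :=
      ((intervalIntegral.intervalIntegrable_rpow' (by linarith)).const_mul r).1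
    refine Integrable.mono' this (by fun_prop) ?_
    refine (ae_restrict_mem measurableSet_Ioc).mono fun s hs => ?_
    have hs0 := hs.1
    have e1 : Real.exp (-s * r) ≤ 1 := Real.exp_le_one_iff.2 (by nlinarith)
    have e2 : 1 - Real.exp (-s * r) ≤ s * r := by
      have := Real.add_one_le_exp (-s * r); linarith
    rw [Real.norm_of_nonneg (mul_nonneg (by linarith) (by positivity))]
    calc _ ≤ s * r * s ^ (-1 - β) := by gcongr
      _ = r * (s ^ (1 : ℝ) * s ^ (-1 - β)) := by rw [Real.rpow_one]; ring
      _ = r * s ^ (-β) := by rw [← Real.rpow_add hs0]; ring_nf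
  · have : IntegrableOn (fun s : ℝ => s ^ (-1 - β)) (Set.Ioi 1) :=
      integrableOn_Ioi_rpow_of_lt (by linarith) one_pos
    refine Integrable.mono' this (by fun_prop) ?_
    refine (ae_restrict_mem measurableSet_Ioi).mono fun s hs => ?_
    have hs0 : 0 < s := one_pos.trans hs
    have e1 : Real.exp (-s * r) ≤ 1 := Real.exp_le_one_iff.2 (by nlinarith)
    rw [Real.norm_of_nonneg (mul_nonneg (by linarith) (by positivity))]
    exact mul_le_of_le_one_left (by positivity) (by have := Real.exp_pos (-s * r); linarith)

/-- Scaling of the Lévy integral. -/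
theorem integral_one_sub_exp_mul_rpow {β r : ℝ} (h0 : 0 < β) (hr : 0 ≤ r) :
    ∫ s in Set.Ioi (0 : ℝ), (1 - Real.exp (-s * r)) * s ^ (-1 - β) =
      (∫ s in Set.Ioi (0 : ℝ), (1 - Real.exp (-s)) * s ^ (-1 - β)) * r ^ β := by
  rcases hr.eq_or_lt with rfl | hr
  · simp [Real.zero_rpow h0.ne']
  have := integral_comp_mul_left_Ioi (fun s => (1 - Real.exp (-s)) * s ^ (-1 - β)) 0 hr
  rw [mul_zero, smul_eq_mul] at this
  have h2 : ∫ s in Set.Ioi (0 : ℝ), (1 - Real.exp (-s * r)) * s ^ (-1 - β) =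
      r ^ (1 + β) * ∫ s in Set.Ioi (0 : ℝ), (1 - Real.exp (-(r * s))) * (r * s) ^ (-1 - β) := by
    rw [← integral_const_mul]
    refine setIntegral_congr_fun measurableSet_Ioi fun s hs => ?_
    have hs0 : 0 < s := hs
    rw [mul_comm r s, ← neg_mul, mul_comm s r, Real.mul_rpow hr.le hs0.le,
      show -1 - β = -(1 + β) by ring, Real.rpow_neg hr.le]
    have : r ^ (1 + β) ≠ 0 := (Real.rpow_pos_of_pos hr _).ne'
    field_simp
  rw [h2, this, Real.rpow_add hr, Real.rpow_one]
  field_simp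

theorem integral_one_sub_exp_mul_rpow_pos {β : ℝ} (h0 : 0 < β) (h1 : β < 1) :
    0 < ∫ s in Set.Ioi (0 : ℝ), (1 - Real.exp (-s)) * s ^ (-1 - β) := by
  have hi := integrableOn_one_sub_exp_mul_rpow h0 h1 zero_le_one
  simp only [mul_one] at hi
  have hpos : ∀ s : ℝ, 0 < s → 0 < (1 - Real.exp (-s)) * s ^ (-1 - β) := fun s hs =>
    mul_pos (by have := Real.exp_lt_one_iff.2 (neg_lt_zero.2 hs); linarith) (Real.rpow_pos_of_pos hs _)
  rw [setIntegral_pos_iff_support_of_nonneg_ae _ hi]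
  · have : Set.Ioi (0 : ℝ) ⊆
        (Function.support fun s : ℝ => (1 - Real.exp (-s)) * s ^ (-1 - β)) ∩ Set.Ioi 0 :=
      fun s hs => ⟨(hpos s hs).ne', hs⟩
    refine lt_of_lt_of_le ?_ (measure_mono this)
    simp
  · exact (ae_restrict_mem measurableSet_Ioi).mono fun s hs => (hpos s hs).le

/-- Bochner subordination in dual form: a function `h` that is nonnegative against each
`exp (-δ ρ)` is nonnegative against each `exp (-t ρ ^ β)`, `0 < β < 1`. -/
theorem integral_exp_neg_rpow_mul_nonneg {X : Type*} [MeasurableSpace X] {μ : Measure X} [SFinite μ]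
    {ρ h : X → ℝ} {B β t : ℝ} (h0 : 0 < β) (h1 : β < 1) (ht : 0 < t)
    (hρ : Measurable ρ) (hρ0 : ∀ x, 0 ≤ ρ x)
    (hh : Measurable h) (hB : ∀ x, |h x| ≤ B)
    (hint : ∀ δ : ℝ, 0 < δ → Integrable (fun x => Real.exp (-δ * ρ x)) μ)
    (hint' : Integrable (fun x => Real.exp (-t * ρ x ^ β)) μ)
    (hA : ∀ δ : ℝ, 0 < δ → 0 ≤ ∫ x, Real.exp (-δ * ρ x) * h x ∂μ) :
    0 ≤ ∫ x, Real.exp (-t * ρ x ^ β) * h x ∂μ := by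
  set c := ∫ s in Set.Ioi (0 : ℝ), (1 - Real.exp (-s)) * s ^ (-1 - β) with hc
  have hc0 : 0 < c := integral_one_sub_exp_mul_rpow_pos h0 h1
  have hA1 : LaplaceNonneg μ ρ h (fun _ => 1) := fun δ hδ => by simpa using hA δ hδ
  -- The Lévy measure s^(-1-β) ds is infinite at 0, so it is cut off at a n. The factor t / c makes
  -- L n r - L n 0 tend to -t r^β, and exp (L n r) is covered by `exp_laplace`.
  set a : ℕ → ℝ := fun n => 1 / ((n : ℝ) + 1) with ha
  have ha0 : ∀ n, 0 < a n := fun n => by positivity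
  have hk0 : ∀ n s, a n < s → 0 ≤ t / c * s ^ (-1 - β) := fun n s hs => by
    have := (ha0 n).trans hs
    positivity
  have hki : ∀ n, IntegrableOn (fun s : ℝ => t / c * s ^ (-1 - β)) (Set.Ioi (a n)) := fun n =>
    (integrableOn_Ioi_rpow_of_lt (by linarith) (ha0 n)).const_mul _
  set L : ℕ → ℝ → ℝ := fun n r => ∫ s in Set.Ioi (a n), Real.exp (-s * r) * (t / c * s ^ (-1 - β))
  have hdiff : ∀ n r, 0 ≤ r → L n r - L n 0
      = - (t / c * ∫ s in Set.Ioi (a n), (1 - Real.exp (-s * r)) * s ^ (-1 - β)) := by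
    intro n r hr
    have hLi : ∀ r, 0 ≤ r → IntegrableOn (fun s => Real.exp (-s * r) * (t / c * s ^ (-1 - β)))
        (Set.Ioi (a n)) := by
      intro r hr
      refine Integrable.mono' (hki n) (by fun_prop) ?_
      refine (ae_restrict_mem measurableSet_Ioi).mono fun s hs => ?_
      have := hk0 n s hs
      rw [Real.norm_of_nonneg (by positivity)]
      refine mul_le_of_le_one_left this (Real.exp_le_one_iff.2 ?_)
      have := (ha0 n).trans hs
      nlinarith
    rw [← integral_const_mul, ← integral_neg, ← integral_sub (hLi r hr) (hLi 0 le_rfl)]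
    congr 1; ext s
    simp only [mul_zero, Real.exp_zero]; ring
  have hexp : ∀ n, LaplaceNonneg μ ρ h (fun r => Real.exp (L n r - L n 0)) := by
    intro n
    have := (hA1.exp_laplace hρ hρ0 hh hB hint (ha0 n).le (by fun_prop) (hki n) (hk0 n)).const_mul
      (Real.exp_pos (-L n 0)).le
    intro δ hδ
    refine (this δ hδ).trans_eq ?_
    congr 1; ext x
    beta_reduce
    rw [show L n (ρ x) - L n 0 = -L n 0 + L n (ρ x) by ring, Real.exp_add]
  have hlevy : ∀ r : ℝ, 0 ≤ r → ∀ s : ℝ, 0 < s → 0 ≤ (1 - Real.exp (-s * r)) * s ^ (-1 - β) :=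
    fun r hr s hs => mul_nonneg
      (by have : Real.exp (-s * r) ≤ 1 := Real.exp_le_one_iff.2 (by nlinarith)
          linarith) (by positivity)
  have hlim : LaplaceNonneg μ ρ h (fun r => Real.exp (-t * r ^ β)) := by
    have hm : ∀ n, Measurable (fun r => Real.exp (L n r - L n 0)) := by
      intro n
      have : StronglyMeasurable (L n) := by
        refine StronglyMeasurable.integral_prod_right (f := fun r s =>
          Real.exp (-s * r) * (t / c * s ^ (-1 - β))) (Measurable.stronglyMeasurable ?_)
        simp only [Function.uncurry_def]
        fun_prop
      exact (this.measurable.sub_const _).exp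
    refine LaplaceNonneg.of_tendsto hexp hρ hρ0 hh hB hm (C := 1) ?_ hint ?_
    · intro n r hr
      rw [Real.abs_exp, hdiff n r hr]
      refine Real.exp_le_one_iff.2 (neg_nonpos.2 (mul_nonneg (by positivity)
        (setIntegral_nonneg measurableSet_Ioi fun s hs => hlevy r hr s ((ha0 n).trans hs))))
    · intro r hr
      refine (Real.continuous_exp.tendsto _).comp ?_
      have hU : ⋃ n, Set.Ioi (a n) = Set.Ioi (0 : ℝ) := by
        ext s
        simp only [Set.mem_iUnion, Set.mem_Ioi]
        refine ⟨fun ⟨n, hn⟩ => (ha0 n).trans hn, fun hs => ?_⟩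
        exact exists_nat_one_div_lt hs
      have hT := tendsto_setIntegral_of_monotone (s := fun n => Set.Ioi (a n)) (μ := volume)
        (f := fun s => (1 - Real.exp (-s * r)) * s ^ (-1 - β)) (fun n => measurableSet_Ioi)
        (fun m n hmn => Set.Ioi_subset_Ioi (one_div_le_one_div_of_le (by positivity)
          (by exact_mod_cast Nat.succ_le_succ hmn)))
        (by rw [hU]; exact integrableOn_one_sub_exp_mul_rpow h0 h1 hr)
      rw [hU, integral_one_sub_exp_mul_rpow h0 hr] at hT
      have := (hT.const_mul (t / c)).neg
      refine (this.congr fun n => (hdiff n r hr).symm).trans (le_of_eq ?_)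
      congr 1
      rw [← hc]
      field_simp
  -- The auxiliary weight exp (-δ ρ) is removed by letting δ tend to 0.
  refine ge_of_tendsto (f := fun δ : ℝ => ∫ x, Real.exp (-δ * ρ x) * Real.exp (-t * ρ x ^ β) * h x ∂μ)
    (x := 𝓝[>] 0) ?_ (eventually_mem_nhdsWithin.mono fun δ hδ => hlim δ hδ)
  refine tendsto_integral_filter_of_dominated_convergence
    (fun x => Real.exp (-t * ρ x ^ β) * B) ?_ ?_ (hint'.mul_const B) (ae_of_all _ fun x => ?_)
  · exact Eventually.of_forall fun δ => Measurable.aestronglyMeasurable (by fun_prop)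
  · refine eventually_mem_nhdsWithin.mono fun δ hδ => ae_of_all _ fun x => ?_
    rw [norm_mul, norm_mul, Real.norm_eq_abs, Real.norm_eq_abs, Real.norm_eq_abs, Real.abs_exp,
      Real.abs_exp]
    have : Real.exp (-δ * ρ x) ≤ 1 := Real.exp_le_one_iff.2 (by
      have := hρ0 x
      have := Set.mem_Ioi.1 hδ
      nlinarith)
    exact mul_le_mul (mul_le_of_le_one_left (Real.exp_pos _).le this) (hB x) (abs_nonneg _)
      (Real.exp_pos _).le
  · have : Tendsto (fun δ : ℝ => Real.exp (-δ * ρ x) * Real.exp (-t * ρ x ^ β) * h x) (𝓝 0)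
        (𝓝 (Real.exp (-0 * ρ x) * Real.exp (-t * ρ x ^ β) * h x)) :=
      Continuous.tendsto (by fun_prop) 0
    simp only [neg_zero, zero_mul, Real.exp_zero, one_mul] at this
    exact this.mono_left nhdsWithin_le_nhds

/-! ### The kernel: positivity, monotonicity, mass, semigroup law. -/

/-- The Fourier symbol `exp (-t |2πξ|^α)` of the semigroup. -/
noncomputable def fracSymbol {d : ℕ} (α t : ℝ) (ξ : EuclideanSpace ℝ (Fin d)) : ℝ :=
  Real.exp (-t * (2 * Real.pi * ‖ξ‖) ^ α)

section Kernel

variable {d : ℕ} {α t s : ℝ}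

theorem fracSymbol_neg (ξ : EuclideanSpace ℝ (Fin d)) : fracSymbol α t (-ξ) = fracSymbol α t ξ := by
  simp [fracSymbol]

theorem fracSymbol_mul (ξ : EuclideanSpace ℝ (Fin d)) :
    fracSymbol α t ξ * fracSymbol α s ξ = fracSymbol α (t + s) ξ := by
  rw [fracSymbol, fracSymbol, fracSymbol, ← Real.exp_add]; ring_nf

theorem fracSymbol_le_one (ht : 0 ≤ t) (ξ : EuclideanSpace ℝ (Fin d)) : fracSymbol α t ξ ≤ 1 :=
  Real.exp_le_one_iff.2 (by
    have : 0 ≤ (2 * Real.pi * ‖ξ‖) ^ α := by positivity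
    nlinarith)

theorem continuous_fracSymbol (hα : 0 < α) :
    Continuous (fracSymbol α t : EuclideanSpace ℝ (Fin d) → ℝ) := by
  have : Continuous fun ξ : EuclideanSpace ℝ (Fin d) => (2 * Real.pi * ‖ξ‖) ^ α :=
    Continuous.rpow_const (by fun_prop) fun _ => Or.inr hα.le
  exact Real.continuous_exp.comp (continuous_const.mul this)

theorem integrable_fracSymbol [NeZero d] (hα : 0 < α) (ht : 0 < t) :
    Integrable (fracSymbol α t : EuclideanSpace ℝ (Fin d) → ℝ) := by
  have := (integrable_fun_norm_addHaar (E := EuclideanSpace ℝ (Fin d)) volume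
    (f := fun r => Real.exp (-t * (2 * Real.pi * r) ^ α))).2 ?_
  · exact this
  · have hn := Nat.cast_nonneg (α := ℝ) (Module.finrank ℝ (EuclideanSpace ℝ (Fin d)) - 1)
    have h := integrableOn_rpow_mul_exp_neg_mul_rpow (p := α)
      (s := ((Module.finrank ℝ (EuclideanSpace ℝ (Fin d)) - 1 : ℕ) : ℝ))
      (b := t * (2 * Real.pi) ^ α) (by linarith) hα (by positivity)
    refine h.congr_fun (fun r hr => ?_) measurableSet_Ioi
    have hr0 : (0 : ℝ) < r := hr
    simp only [Real.rpow_natCast, smul_eq_mul]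
    rw [Real.mul_rpow (by positivity) hr0.le]
    ring_nf

theorem integrable_ofReal_fracSymbol [NeZero d] (hα : 0 < α) (ht : 0 < t) :
    Integrable (fun ξ : EuclideanSpace ℝ (Fin d) => (fracSymbol α t ξ : ℂ)) :=
  (integrable_fracSymbol hα ht).ofReal

theorem fourierInv_fracSymbol (x : EuclideanSpace ℝ (Fin d)) :
    𝓕⁻ (fun ξ : EuclideanSpace ℝ (Fin d) => (fracSymbol α t ξ : ℂ)) x =
      𝓕 (fun ξ : EuclideanSpace ℝ (Fin d) => (fracSymbol α t ξ : ℂ)) x := by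
  rw [Real.fourierInv_eq_fourier_comp_neg]
  simp_rw [fracSymbol_neg]

theorem ofReal_fracHeatKernel (x : EuclideanSpace ℝ (Fin d)) :
    (fracHeatKernel α t x : ℂ) =
      𝓕⁻ (fun ξ : EuclideanSpace ℝ (Fin d) => (fracSymbol α t ξ : ℂ)) x := by
  change (((𝓕⁻ (fun ξ : EuclideanSpace ℝ (Fin d) => (fracSymbol α t ξ : ℂ)) x).re : ℝ) : ℂ) = _
  refine Complex.conj_eq_iff_re.1 ?_
  conv_rhs => rw [fourierInv_fracSymbol]
  rw [Real.fourierInv_eq, Real.fourier_eq, ← integral_conj]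
  congr 1; ext ξ
  rw [Circle.smul_def, Circle.smul_def, smul_eq_mul, smul_eq_mul, map_mul, Complex.conj_ofReal,
    ← Circle.coe_inv_eq_conj, AddChar.map_neg_eq_inv]

theorem ofReal_fracHeatKernel' (x : EuclideanSpace ℝ (Fin d)) :
    (fracHeatKernel α t x : ℂ) =
      𝓕 (fun ξ : EuclideanSpace ℝ (Fin d) => (fracSymbol α t ξ : ℂ)) x := by
  rw [ofReal_fracHeatKernel, fourierInv_fracSymbol]

/-- In this form, sign properties of the kernel become integrals of the symbol against bounded
functions, to which subordination applies. -/
theorem fracHeatKernel_eq_integral_cos [NeZero d] (hα : 0 < α) (ht : 0 < t)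
    (x : EuclideanSpace ℝ (Fin d)) :
    fracHeatKernel α t x =
      ∫ ξ : EuclideanSpace ℝ (Fin d), fracSymbol α t ξ * Real.cos (2 * Real.pi * inner ℝ ξ x) := by
  have hint := integrable_ofReal_fracSymbol (d := d) hα ht
  have h2 : Integrable (fun ξ : EuclideanSpace ℝ (Fin d) =>
      Complex.exp (↑(2 * Real.pi * inner ℝ ξ x) * Complex.I) • (fracSymbol α t ξ : ℂ)) := by
    refine hint.mono ?_ (ae_of_all _ fun ξ => ?_)
    · refine Continuous.aestronglyMeasurable ?_
      have := continuous_fracSymbol (d := d) (t := t) hα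
      fun_prop
    · rw [norm_smul, Complex.norm_exp_ofReal_mul_I, one_mul]
  change (𝓕⁻ (fun ξ : EuclideanSpace ℝ (Fin d) => (fracSymbol α t ξ : ℂ)) x).re = _
  rw [Real.fourierInv_eq']
  have := integral_re h2
  simp only [RCLike.re_to_complex] at this
  rw [← this]
  congr 1; ext ξ
  rw [smul_eq_mul, Complex.re_mul_ofReal, Complex.exp_ofReal_mul_I_re, mul_comm]

theorem continuous_fracHeatKernel [NeZero d] (hα : 0 < α) (ht : 0 < t) :
    Continuous (fracHeatKernel α t : EuclideanSpace ℝ (Fin d) → ℝ) := by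
  have h : Continuous (𝓕 (fun ξ : EuclideanSpace ℝ (Fin d) => (fracSymbol α t ξ : ℂ))) :=
    VectorFourier.fourierIntegral_continuous Real.continuous_fourierChar
      (innerSL ℝ).continuous₂ (integrable_ofReal_fracSymbol hα ht)
  have h2 := Complex.continuous_re.comp h
  refine h2.congr fun x => ?_
  rw [Function.comp_apply, ← ofReal_fracHeatKernel', Complex.ofReal_re]

theorem measurable_fracHeatKernel (α : ℝ) :
    Measurable fun z : ℝ × EuclideanSpace ℝ (Fin d) => fracHeatKernel α z.1 z.2 := by
  have : StronglyMeasurable fun z : ℝ × EuclideanSpace ℝ (Fin d) =>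
      ∫ ξ : EuclideanSpace ℝ (Fin d), Complex.exp (↑(2 * Real.pi * inner ℝ ξ z.2) * Complex.I) •
        ((Real.exp (-z.1 * (2 * Real.pi * ‖ξ‖) ^ α) : ℝ) : ℂ) := by
    refine StronglyMeasurable.integral_prod_right
      (f := fun (z : ℝ × EuclideanSpace ℝ (Fin d)) (ξ : EuclideanSpace ℝ (Fin d)) =>
        Complex.exp (↑(2 * Real.pi * inner ℝ ξ z.2) * Complex.I) •
        ((Real.exp (-z.1 * (2 * Real.pi * ‖ξ‖) ^ α) : ℝ) : ℂ)) (Measurable.stronglyMeasurable ?_)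
    simp only [Function.uncurry_def]
    fun_prop
  have h2 := Complex.measurable_re.comp this.measurable
  simp only [Function.comp_def] at h2
  simp only [fracHeatKernel, Real.fourierInv_eq']
  exact h2

theorem integrable_exp_neg_mul_sq_norm {b : ℝ} (hb : 0 < b) :
    Integrable fun ξ : EuclideanSpace ℝ (Fin d) => Real.exp (-b * ‖ξ‖ ^ 2) := by
  have := (GaussianFourier.integrable_cexp_neg_mul_sq_norm_add
    (V := EuclideanSpace ℝ (Fin d)) (b := (b : ℂ)) (by simpa) 0 0).re
  refine this.congr (ae_of_all _ fun ξ => ?_)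
  simp only [zero_mul, add_zero, RCLike.re_to_complex]
  rw [← Complex.exp_ofReal_re]
  push_cast
  rfl

theorem fourier_exp_neg_mul_sq_norm {b : ℝ} (hb : 0 < b) (x : EuclideanSpace ℝ (Fin d)) :
    𝓕 (fun ξ : EuclideanSpace ℝ (Fin d) => ((Real.exp (-b * ‖ξ‖ ^ 2) : ℝ) : ℂ)) x =
      (((Real.pi / b) ^ ((d : ℝ) / 2) * Real.exp (-(Real.pi ^ 2 / b) * ‖x‖ ^ 2) : ℝ) : ℂ) := by
  have := fourier_gaussian_innerProductSpace (b := (b : ℂ)) (by simpa) x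
  simp only [finrank_euclideanSpace, Fintype.card_fin] at this
  push_cast
  rw [this]
  rw [← Complex.ofReal_div, Complex.ofReal_cpow (by positivity)]
  push_cast
  congr 2
  ring

theorem integral_exp_neg_mul_sq_norm_mul_cos {b : ℝ} (hb : 0 < b)
    (x : EuclideanSpace ℝ (Fin d)) :
    ∫ ξ : EuclideanSpace ℝ (Fin d),
      Real.exp (-b * ‖ξ‖ ^ 2) * Real.cos (2 * Real.pi * inner ℝ ξ x) =
      (Real.pi / b) ^ ((d : ℝ) / 2) * Real.exp (-(Real.pi ^ 2 / b) * ‖x‖ ^ 2) := by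
  have h1 := congrArg Complex.re (fourier_exp_neg_mul_sq_norm hb x)
  rw [Complex.ofReal_re, Real.fourier_eq'] at h1
  have h2 : Integrable (fun ξ : EuclideanSpace ℝ (Fin d) =>
      Complex.exp (↑(-2 * Real.pi * inner ℝ ξ x) * Complex.I) •
        ((Real.exp (-b * ‖ξ‖ ^ 2) : ℝ) : ℂ)) := by
    refine ((integrable_exp_neg_mul_sq_norm hb).ofReal (𝕜 := ℂ)).mono ?_ (ae_of_all _ fun ξ => ?_)
    · exact Continuous.aestronglyMeasurable (by fun_prop)
    · rw [norm_smul, Complex.norm_exp_ofReal_mul_I, one_mul]; rfl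
  have h3 := integral_re h2
  simp only [RCLike.re_to_complex] at h3
  rw [← h1, ← h3]
  congr 1; ext ξ
  rw [smul_eq_mul, Complex.re_mul_ofReal, Complex.exp_ofReal_mul_I_re, mul_comm,
    show -2 * Real.pi * inner ℝ ξ x = -(2 * Real.pi * inner ℝ ξ x) by ring, Real.cos_neg]

theorem fracHeatKernel_two [NeZero d] (ht : 0 < t) (x : EuclideanSpace ℝ (Fin d)) :
    fracHeatKernel 2 t x =
      (4 * Real.pi * t) ^ (-((d : ℝ) / 2)) * Real.exp (-(‖x‖ ^ 2 / (4 * t))) := by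
  rw [fracHeatKernel_eq_integral_cos two_pos ht]
  have := integral_exp_neg_mul_sq_norm_mul_cos (b := t * (4 * Real.pi ^ 2)) (by positivity) x
  have h2 : ∀ ξ : EuclideanSpace ℝ (Fin d), fracSymbol 2 t ξ =
      Real.exp (-(t * (4 * Real.pi ^ 2)) * ‖ξ‖ ^ 2) := by
    intro ξ
    rw [fracSymbol, Real.rpow_two]; ring_nf
  simp_rw [h2, this]
  rw [Real.rpow_neg (by positivity), ← Real.inv_rpow (by positivity)]
  congr 2
  · field_simp
  · field_simp

/-- Subordination with ρ = |ξ|² and β = α/2; for α = 2 the symbol is itself a Gaussian. -/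
theorem integral_fracSymbol_mul_nonneg [NeZero d] (hα : 0 < α) (hα2 : α ≤ 2) (ht : 0 < t)
    {h : EuclideanSpace ℝ (Fin d) → ℝ} {B : ℝ} (hh : Measurable h) (hB : ∀ x, |h x| ≤ B)
    (hA : ∀ δ : ℝ, 0 < δ → 0 ≤ ∫ ξ, Real.exp (-δ * ‖ξ‖ ^ 2) * h ξ) :
    0 ≤ ∫ ξ, fracSymbol α t ξ * h ξ := by
  rcases hα2.eq_or_lt with rfl | hα2
  · refine (hA (t * (4 * Real.pi ^ 2)) (by positivity)).trans_eq ?_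
    congr 1; ext ξ
    rw [fracSymbol, Real.rpow_two]; ring_nf
  · have h2 : ∀ ξ : EuclideanSpace ℝ (Fin d), fracSymbol α t ξ =
        Real.exp (-(t * (2 * Real.pi) ^ α) * (‖ξ‖ ^ 2) ^ (α / 2)) := by
      intro ξ
      rw [fracSymbol, Real.mul_rpow (by positivity) (by positivity), ← Real.rpow_natCast,
        ← Real.rpow_mul (norm_nonneg _)]
      congr 1
      rw [show ((2 : ℕ) : ℝ) * (α / 2) = α by push_cast; ring]; ring
    simp_rw [h2]
    refine integral_exp_neg_rpow_mul_nonneg (ρ := fun ξ : EuclideanSpace ℝ (Fin d) => ‖ξ‖ ^ 2)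
      (by linarith) (by linarith) (by positivity)
      (by fun_prop) (fun _ => by positivity) hh hB (fun δ hδ => integrable_exp_neg_mul_sq_norm hδ)
      ?_ hA
    simp_rw [← h2]
    exact integrable_fracSymbol hα ht

/-- The Fourier transform of a Gaussian is positive, and subordination carries this over with h a
cosine. -/
theorem fracHeatKernel_nonneg [NeZero d] (hα : 0 < α) (hα2 : α ≤ 2) (ht : 0 < t)
    (x : EuclideanSpace ℝ (Fin d)) : 0 ≤ fracHeatKernel α t x := by
  rw [fracHeatKernel_eq_integral_cos hα ht]
  refine integral_fracSymbol_mul_nonneg hα hα2 ht (B := 1) (by fun_prop)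
    (fun ξ => Real.abs_cos_le_one _) fun δ hδ => ?_
  rw [integral_exp_neg_mul_sq_norm_mul_cos hδ]
  positivity

theorem integrable_mul_cos {f : EuclideanSpace ℝ (Fin d) → ℝ} (hf : Integrable f)
    (x : EuclideanSpace ℝ (Fin d)) :
    Integrable fun ξ => f ξ * Real.cos (2 * Real.pi * inner ℝ ξ x) := by
  refine hf.mul_bdd (c := 1) (by fun_prop) (ae_of_all _ fun ξ => ?_)
  exact Real.abs_cos_le_one _

/-- The Fourier transform of a Gaussian decreases with the norm; subordination is applied to the
difference of the two cosines. -/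
theorem fracHeatKernel_anti [NeZero d] (hα : 0 < α) (hα2 : α ≤ 2) (ht : 0 < t)
    {x y : EuclideanSpace ℝ (Fin d)} (hxy : ‖x‖ ≤ ‖y‖) :
    fracHeatKernel α t y ≤ fracHeatKernel α t x := by
  have hi := integrable_fracSymbol (d := d) hα ht
  rw [fracHeatKernel_eq_integral_cos hα ht, fracHeatKernel_eq_integral_cos hα ht, ← sub_nonneg,
    ← integral_sub (integrable_mul_cos hi x) (integrable_mul_cos hi y)]
  simp_rw [← mul_sub]
  refine integral_fracSymbol_mul_nonneg hα hα2 ht (B := 2) (by fun_prop) (fun ξ => ?_)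
    fun δ hδ => ?_
  · rw [abs_le]
    constructor <;>
    linarith [Real.cos_le_one (2 * Real.pi * inner ℝ ξ x), Real.cos_le_one (2 * Real.pi * inner ℝ ξ y),
      Real.neg_one_le_cos (2 * Real.pi * inner ℝ ξ x),
      Real.neg_one_le_cos (2 * Real.pi * inner ℝ ξ y)]
  · have hg := integrable_exp_neg_mul_sq_norm (d := d) hδ
    simp_rw [mul_sub]
    rw [integral_sub (integrable_mul_cos hg x) (integrable_mul_cos hg y),
      integral_exp_neg_mul_sq_norm_mul_cos hδ, integral_exp_neg_mul_sq_norm_mul_cos hδ, sub_nonneg]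
    refine mul_le_mul_of_nonneg_left (Real.exp_le_exp.2 ?_) (by positivity)
    rw [neg_mul, neg_mul, neg_le_neg_iff]
    gcongr

theorem fracHeatKernel_congr_norm [NeZero d] (hα : 0 < α) (hα2 : α ≤ 2) (ht : 0 < t)
    {x y : EuclideanSpace ℝ (Fin d)} (hxy : ‖x‖ = ‖y‖) :
    fracHeatKernel α t x = fracHeatKernel α t y :=
  le_antisymm (fracHeatKernel_anti hα hα2 ht hxy.ge) (fracHeatKernel_anti hα hα2 ht hxy.le)

theorem fracHeatKernel_rpow_smul [NeZero d] (hα : 0 < α) {c : ℝ} (hc : 0 < c)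
    (x : EuclideanSpace ℝ (Fin d)) :
    fracHeatKernel α (c ^ α) (c • x) = (c ^ d)⁻¹ * fracHeatKernel α 1 x := by
  rw [fracHeatKernel_eq_integral_cos hα (by positivity),
    fracHeatKernel_eq_integral_cos hα one_pos]
  have := Measure.integral_comp_smul (volume : Measure (EuclideanSpace ℝ (Fin d)))
    (fun ξ => fracSymbol α 1 ξ * Real.cos (2 * Real.pi * inner ℝ ξ x)) c
  rw [finrank_euclideanSpace, Fintype.card_fin, abs_of_pos (by positivity), smul_eq_mul] at this
  rw [← this]
  congr 1; ext ξ
  rw [inner_smul_left, inner_smul_right, fracSymbol, fracSymbol, norm_smul, Real.norm_of_nonneg hc.le,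
    show 2 * Real.pi * (c * ‖ξ‖) = c * (2 * Real.pi * ‖ξ‖) by ring,
    Real.mul_rpow hc.le (by positivity)]
  simp

/-- Multiplication formula for the kernel against a Gaussian. -/
theorem integral_fracHeatKernel_mul_exp [NeZero d] (hα : 0 < α) (ht : 0 < t) {b : ℝ} (hb : 0 < b) :
    ∫ x : EuclideanSpace ℝ (Fin d), fracHeatKernel α t x * Real.exp (-b * ‖x‖ ^ 2) =
      ∫ ξ : EuclideanSpace ℝ (Fin d), fracSymbol α t ξ *
        ((Real.pi / b) ^ ((d : ℝ) / 2) * Real.exp (-(Real.pi ^ 2 / b) * ‖ξ‖ ^ 2)) := by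
  have h := VectorFourier.integral_fourierIntegral_smul_eq_flip
    (L := innerₗ (EuclideanSpace ℝ (Fin d))) (μ := volume) (ν := volume)
    (f := fun ξ => (fracSymbol α t ξ : ℂ)) (g := fun x => ((Real.exp (-b * ‖x‖ ^ 2) : ℝ) : ℂ))
    Real.continuous_fourierChar continuous_inner (integrable_ofReal_fracSymbol hα ht)
    (integrable_exp_neg_mul_sq_norm hb).ofReal
  rw [flip_innerₗ] at h
  change ∫ x, 𝓕 (fun ξ => (fracSymbol α t ξ : ℂ)) x • _ = ∫ ξ, _ • 𝓕 (fun x : EuclideanSpace ℝ (Fin d) => ((Real.exp (-b * ‖x‖ ^ 2) : ℝ) : ℂ)) ξ at h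
  simp_rw [← ofReal_fracHeatKernel', fourier_exp_neg_mul_sq_norm hb, smul_eq_mul,
    ← Complex.ofReal_mul] at h
  rw [integral_complex_ofReal, integral_complex_ofReal] at h
  exact_mod_cast h

theorem integral_gaussian_dual {b : ℝ} (hb : 0 < b) :
    ∫ ξ : EuclideanSpace ℝ (Fin d),
      (Real.pi / b) ^ ((d : ℝ) / 2) * Real.exp (-(Real.pi ^ 2 / b) * ‖ξ‖ ^ 2) = 1 := by
  rw [integral_const_mul, GaussianFourier.integral_rexp_neg_mul_sq_norm (by positivity),
    finrank_euclideanSpace, Fintype.card_fin, ← Real.mul_rpow (by positivity) (by positivity)]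
  rw [show Real.pi / b * (Real.pi / (Real.pi ^ 2 / b)) = 1 by field_simp, Real.one_rpow]

theorem integrable_fracHeatKernel_mul_exp [NeZero d] (hα : 0 < α) (ht : 0 < t) {b : ℝ}
    (hb : 0 < b) :
    Integrable fun x : EuclideanSpace ℝ (Fin d) =>
      fracHeatKernel α t x * Real.exp (-b * ‖x‖ ^ 2) := by
  refine (integrable_exp_neg_mul_sq_norm hb).bdd_mul (c := ∫ ξ : EuclideanSpace ℝ (Fin d), ‖fracSymbol α t ξ‖)
    (continuous_fracHeatKernel hα ht).aestronglyMeasurable (ae_of_all _ fun x => ?_)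
  rw [fracHeatKernel_eq_integral_cos hα ht]
  refine (norm_integral_le_integral_norm _).trans
    (integral_mono (integrable_mul_cos (integrable_fracSymbol hα ht) x).norm
      (integrable_fracSymbol hα ht).norm fun ξ => ?_)
  rw [norm_mul]
  exact mul_le_of_le_one_right (norm_nonneg _) (Real.abs_cos_le_one _)

/-- On the Fourier side the symbol is at most 1 and the dual Gaussian has integral 1. -/
theorem integral_fracHeatKernel_mul_exp_le [NeZero d] (hα : 0 < α) (ht : 0 < t) {b : ℝ}
    (hb : 0 < b) :
    ∫ x : EuclideanSpace ℝ (Fin d), fracHeatKernel α t x * Real.exp (-b * ‖x‖ ^ 2) ≤ 1 := by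
  have hi : Integrable fun ξ : EuclideanSpace ℝ (Fin d) =>
      (Real.pi / b) ^ ((d : ℝ) / 2) * Real.exp (-(Real.pi ^ 2 / b) * ‖ξ‖ ^ 2) :=
    (integrable_exp_neg_mul_sq_norm (by positivity)).const_mul _
  rw [integral_fracHeatKernel_mul_exp hα ht hb, ← integral_gaussian_dual (d := d) hb]
  refine integral_mono_of_nonneg (ae_of_all _ fun ξ => ?_) hi (ae_of_all _ fun ξ => ?_)
  · exact mul_nonneg (Real.exp_pos _).le (by positivity)
  · exact mul_le_of_le_one_left (by positivity) (fracSymbol_le_one ht.le ξ)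

/-- Integrability is not known beforehand, so the kernel is damped by a Gaussian and Fatou's lemma
removes the damping. A bound by 1, rather than equality, is all that Jensen's inequality needs. -/
theorem lintegral_fracHeatKernel_le_one [NeZero d] (hα : 0 < α) (hα2 : α ≤ 2) (ht : 0 < t) :
    ∫⁻ x : EuclideanSpace ℝ (Fin d), ENNReal.ofReal (fracHeatKernel α t x) ≤ 1 := by
  have hc := continuous_fracHeatKernel (d := d) hα ht
  have hb : ∀ n : ℕ, (0 : ℝ) < 1 / ((n : ℝ) + 1) := fun n => by positivity
  have h1 : ∀ n : ℕ, ∫⁻ x : EuclideanSpace ℝ (Fin d), ENNReal.ofReal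
      (fracHeatKernel α t x * Real.exp (-(1 / ((n : ℝ) + 1)) * ‖x‖ ^ 2)) ≤ 1 := by
    intro n
    rw [← ofReal_integral_eq_lintegral_ofReal (integrable_fracHeatKernel_mul_exp hα ht (hb n))
      (ae_of_all _ fun x => mul_nonneg (fracHeatKernel_nonneg hα hα2 ht x) (Real.exp_pos _).le)]
    exact ENNReal.ofReal_le_one.2 (integral_fracHeatKernel_mul_exp_le hα ht (hb n))
  have h2 : ∀ x : EuclideanSpace ℝ (Fin d), Tendsto (fun n : ℕ => ENNReal.ofReal
      (fracHeatKernel α t x * Real.exp (-(1 / ((n : ℝ) + 1)) * ‖x‖ ^ 2))) atTop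
      (𝓝 (ENNReal.ofReal (fracHeatKernel α t x))) := by
    intro x
    have : Tendsto (fun b : ℝ => fracHeatKernel α t x * Real.exp (-b * ‖x‖ ^ 2)) (𝓝 0)
        (𝓝 (fracHeatKernel α t x * Real.exp (-0 * ‖x‖ ^ 2))) :=
      Continuous.tendsto (by fun_prop) 0
    simp only [neg_zero, zero_mul, Real.exp_zero, mul_one] at this
    exact ENNReal.tendsto_ofReal (this.comp tendsto_one_div_add_atTop_nhds_zero_nat)
  calc _ = ∫⁻ x : EuclideanSpace ℝ (Fin d), liminf (fun n : ℕ => ENNReal.ofReal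
      (fracHeatKernel α t x * Real.exp (-(1 / ((n : ℝ) + 1)) * ‖x‖ ^ 2))) atTop := by
        congr 1; ext x; exact (h2 x).liminf_eq.symm
    _ ≤ liminf (fun n : ℕ => ∫⁻ x : EuclideanSpace ℝ (Fin d), ENNReal.ofReal
      (fracHeatKernel α t x * Real.exp (-(1 / ((n : ℝ) + 1)) * ‖x‖ ^ 2))) atTop :=
        lintegral_liminf_le fun n => by fun_prop
    _ ≤ 1 := (liminf_le_liminf (Eventually.of_forall h1)).trans_eq (by simp)

theorem integrable_fracHeatKernel [NeZero d] (hα : 0 < α) (hα2 : α ≤ 2) (ht : 0 < t) :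
    Integrable (fracHeatKernel α t : EuclideanSpace ℝ (Fin d) → ℝ) := by
  refine ⟨(continuous_fracHeatKernel hα ht).aestronglyMeasurable, ?_⟩
  rw [hasFiniteIntegral_iff_ofReal (ae_of_all _ (fracHeatKernel_nonneg hα hα2 ht))]
  exact (lintegral_fracHeatKernel_le_one hα hα2 ht).trans_lt ENNReal.one_lt_top

theorem fourier_fracHeatKernel [NeZero d] (hα : 0 < α) (hα2 : α ≤ 2) (ht : 0 < t)
    (ξ : EuclideanSpace ℝ (Fin d)) :
    𝓕 (fun x : EuclideanSpace ℝ (Fin d) => (fracHeatKernel α t x : ℂ)) ξ = fracSymbol α t ξ := by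
  have hi := (integrable_fracHeatKernel (d := d) hα hα2 ht).ofReal (𝕜 := ℂ)
  have h := Continuous.fourier_fourierInv_eq
    (f := fun ξ : EuclideanSpace ℝ (Fin d) => (fracSymbol α t ξ : ℂ))
    (Complex.continuous_ofReal.comp (continuous_fracSymbol hα)) (integrable_ofReal_fracSymbol hα ht)
    (hi.congr (ae_of_all _ fun x => ofReal_fracHeatKernel' x))
  have h2 : (fun x : EuclideanSpace ℝ (Fin d) => (fracHeatKernel α t x : ℂ)) =
    𝓕⁻ (fun ξ : EuclideanSpace ℝ (Fin d) => (fracSymbol α t ξ : ℂ)) :=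
    funext ofReal_fracHeatKernel
  rw [h2, h]

/-- The Chapman-Kolmogorov equation. -/
theorem integral_fracHeatKernel_mul [NeZero d] (hα : 0 < α) (hα2 : α ≤ 2) (ht : 0 < t) (hs : 0 < s)
    (x : EuclideanSpace ℝ (Fin d)) :
    ∫ y, fracHeatKernel α t (x - y) * fracHeatKernel α s y = fracHeatKernel α (t + s) x := by
  have hi := (integrable_fracHeatKernel (d := d) hα hα2 ht).ofReal (𝕜 := ℂ)
  -- The multiplication formula for a translated kernel at time t and the symbol at time s: one side
  -- is the convolution, the other the inverse transform of the product of symbols. Radial symmetry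
  -- absorbs the sign of x - y.
  have h := VectorFourier.integral_fourierIntegral_smul_eq_flip
    (L := innerₗ (EuclideanSpace ℝ (Fin d))) (μ := volume) (ν := volume)
    (f := fun y => (fracHeatKernel α t (y + -x) : ℂ)) (g := fun ξ => (fracSymbol α s ξ : ℂ))
    Real.continuous_fourierChar continuous_inner (hi.comp_add_right (-x))
    (integrable_ofReal_fracSymbol hα hs)
  have h1 := VectorFourier.fourierIntegral_comp_add_right Real.fourierChar
    (volume : Measure (EuclideanSpace ℝ (Fin d))) (innerₗ (EuclideanSpace ℝ (Fin d)))
    (fun y => (fracHeatKernel α t y : ℂ)) (-x)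
  simp only [Function.comp_def] at h1
  rw [h1, flip_innerₗ] at h
  change ∫ ξ, (Real.fourierChar (inner ℝ (-x) ξ) •
    𝓕 (fun y : EuclideanSpace ℝ (Fin d) => (fracHeatKernel α t y : ℂ)) ξ) • _ =
    ∫ ξ, _ • 𝓕 (fun ξ : EuclideanSpace ℝ (Fin d) => (fracSymbol α s ξ : ℂ)) ξ at h
  simp_rw [← ofReal_fracHeatKernel', fourier_fracHeatKernel hα hα2 ht, smul_eq_mul,
    smul_mul_assoc, ← Complex.ofReal_mul, fracSymbol_mul] at h
  rw [integral_complex_ofReal] at h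
  have h3 : ∫ ξ : EuclideanSpace ℝ (Fin d),
      Real.fourierChar (inner ℝ (-x) ξ) • ((fracSymbol α (t + s) ξ : ℝ) : ℂ) =
      (fracHeatKernel α (t + s) x : ℂ) := by
    rw [ofReal_fracHeatKernel', Real.fourier_eq]
    congr 1; ext ξ
    rw [inner_neg_left, real_inner_comm]
  rw [h3] at h
  have h4 : fracHeatKernel α (t + s) x = ∫ y, fracHeatKernel α t (y + -x) * fracHeatKernel α s y := by
    exact_mod_cast h
  rw [h4]
  congr 1; ext y
  rw [fracHeatKernel_congr_norm hα hα2 ht (x := x - y) (y := y + -x)]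
  rw [← sub_eq_add_neg, norm_sub_rev]

theorem lintegral_fracHeatKernel_mul [NeZero d] (hα : 0 < α) (hα2 : α ≤ 2) (ht : 0 < t) (hs : 0 < s)
    (x : EuclideanSpace ℝ (Fin d)) :
    ∫⁻ y, ENNReal.ofReal (fracHeatKernel α t (x - y)) * ENNReal.ofReal (fracHeatKernel α s y) =
      ENNReal.ofReal (fracHeatKernel α (t + s) x) := by
  have hnn := fun y => mul_nonneg (fracHeatKernel_nonneg hα hα2 ht (x - y))
    (fracHeatKernel_nonneg hα hα2 hs y)
  rw [← integral_fracHeatKernel_mul hα hα2 ht hs,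
    ofReal_integral_eq_lintegral_ofReal _ (ae_of_all _ hnn)]
  · simp_rw [ENNReal.ofReal_mul (fracHeatKernel_nonneg hα hα2 ht _)]
  · refine (integrable_fracHeatKernel hα hα2 hs).bdd_mul (c := fracHeatKernel α t (0 : EuclideanSpace ℝ (Fin d))) ?_
      (ae_of_all _ fun y => ?_)
    · exact ((continuous_fracHeatKernel hα ht).comp (by fun_prop)).aestronglyMeasurable
    · rw [Real.norm_of_nonneg (fracHeatKernel_nonneg hα hα2 ht _)]
      exact fracHeatKernel_anti hα hα2 ht (by simp)

/-- A second moment bound within a factor 2 of the exact value d/(2b) (π/b)^(d/2), obtained by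
dominating the integrand by a difference of two Gaussians. -/
theorem integral_sq_norm_mul_exp_le [NeZero d] {b : ℝ} (hb : 0 < b) :
    Integrable (fun ξ : EuclideanSpace ℝ (Fin d) => ‖ξ‖ ^ 2 * Real.exp (-b * ‖ξ‖ ^ 2)) ∧
    ∫ ξ : EuclideanSpace ℝ (Fin d), ‖ξ‖ ^ 2 * Real.exp (-b * ‖ξ‖ ^ 2) ≤
      d / b * (Real.pi / b) ^ ((d : ℝ) / 2) := by
  have hd : (1 : ℝ) ≤ d := by exact_mod_cast NeZero.one_le
  -- A change of rate by the fraction 1/(2d) is small enough for Bernoulli's inequality to give q^d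
  -- ≥ 1/2, so the Gaussian integral grows by at most 3/2 in any dimension.
  set q : ℝ := 1 - 1 / (2 * d) with hq
  have hq1 : 1 / 2 ≤ q := by
    have : 1 / (2 * (d : ℝ)) ≤ 1 / 2 := one_div_le_one_div_of_le (by norm_num) (by linarith)
    linarith
  have hq0 : 0 < q := by linarith
  have hpt : ∀ ξ : EuclideanSpace ℝ (Fin d), ‖ξ‖ ^ 2 * Real.exp (-b * ‖ξ‖ ^ 2) ≤
      2 * d / b * (Real.exp (-(b * q) * ‖ξ‖ ^ 2) - Real.exp (-b * ‖ξ‖ ^ 2)) := by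
    intro ξ
    have h1 := Real.add_one_le_exp (b / (2 * d) * ‖ξ‖ ^ 2)
    have h2 : Real.exp (-(b * q) * ‖ξ‖ ^ 2) =
        Real.exp (b / (2 * d) * ‖ξ‖ ^ 2) * Real.exp (-b * ‖ξ‖ ^ 2) := by
      rw [← Real.exp_add]; congr 1; rw [hq]; field_simp; ring
    rw [h2, ← sub_one_mul, ← mul_assoc]
    refine mul_le_mul_of_nonneg_right ?_ (Real.exp_pos _).le
    calc ‖ξ‖ ^ 2 = 2 * d / b * (b / (2 * d) * ‖ξ‖ ^ 2) := by field_simp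
      _ ≤ _ := by gcongr; linarith
  have hi1 := integrable_exp_neg_mul_sq_norm (d := d) (b := b * q) (by positivity)
  have hi2 := integrable_exp_neg_mul_sq_norm (d := d) hb
  have hi3 := (hi1.sub hi2).const_mul (2 * d / b)
  have hnn : ∀ ξ : EuclideanSpace ℝ (Fin d), 0 ≤ ‖ξ‖ ^ 2 * Real.exp (-b * ‖ξ‖ ^ 2) :=
    fun ξ => by positivity
  refine ⟨hi3.mono' (by fun_prop) (ae_of_all _ fun ξ => ?_), ?_⟩
  · rw [Real.norm_of_nonneg (hnn ξ)]; exact hpt ξ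
  refine (integral_mono_of_nonneg (ae_of_all _ hnn) hi3 (ae_of_all _ hpt)).trans ?_
  simp only [Pi.sub_apply]
  rw [integral_const_mul, integral_sub hi1 hi2, GaussianFourier.integral_rexp_neg_mul_sq_norm hb,
    GaussianFourier.integral_rexp_neg_mul_sq_norm (by positivity), finrank_euclideanSpace,
    Fintype.card_fin]
  have hqd : 1 / 2 ≤ q ^ d := by
    have := one_add_mul_le_pow (a := -(1 / (2 * (d : ℝ)))) (by
      have : 1 / (2 * (d : ℝ)) ≤ 1 / 2 := one_div_le_one_div_of_le (by norm_num) (by linarith)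
      linarith) d
    rw [hq, sub_eq_add_neg]
    refine le_trans (le_of_eq ?_) this
    field_simp; norm_num
  have hqd2 : 2 / 3 ≤ q ^ ((d : ℝ) / 2) := by
    have : (q ^ ((d : ℝ) / 2)) ^ 2 = q ^ d := by
      rw [← Real.rpow_natCast, ← Real.rpow_mul hq0.le, ← Real.rpow_natCast]; congr 1
      push_cast; ring
    have h0 : 0 < q ^ ((d : ℝ) / 2) := by positivity
    nlinarith
  have h5 : (Real.pi / (b * q)) ^ ((d : ℝ) / 2) ≤ 3 / 2 * (Real.pi / b) ^ ((d : ℝ) / 2) := by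
    rw [show Real.pi / (b * q) = Real.pi / b * q⁻¹ by field_simp,
      Real.mul_rpow (by positivity) (by positivity), Real.inv_rpow hq0.le, mul_comm]
    refine mul_le_mul_of_nonneg_right ?_ (by positivity)
    rw [inv_le_comm₀ (by positivity) (by norm_num)]
    linarith
  calc _ ≤ 2 * d / b * (3 / 2 * (Real.pi / b) ^ ((d : ℝ) / 2) - (Real.pi / b) ^ ((d : ℝ) / 2)) := by
        gcongr
    _ = _ := by ring

end Kernel

/-! ### Concentration of the kernel at scale √d. -/

/-- Half of the mass of the kernel at time one lies in a ball of radius `C √d`, with `C`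
independent of the dimension. -/
theorem exists_half_le_integral_ball {α : ℝ} (hα : 0 < α) (hα2 : α ≤ 2) :
    ∃ C : ℝ, 0 < C ∧ ∀ (d : ℕ) [NeZero d],
      1 / 2 ≤ ∫ x in Metric.ball (0 : EuclideanSpace ℝ (Fin d)) (C * √d), fracHeatKernel α 1 x := by
  -- K makes 1 - exp (-|2πξ|^α) ≤ 1/8 + K|ξ|²: either |2πξ|^α ≤ 1/8, or K|ξ|² ≥ 1.
  set K : ℝ := (2 * Real.pi) ^ 2 * (8 : ℝ) ^ (2 / α) with hK
  have hK0 : 0 < K := by positivity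
  have hsymb : ∀ (d : ℕ) (ξ : EuclideanSpace ℝ (Fin d)),
      1 - fracSymbol α 1 ξ ≤ 1 / 8 + K * ‖ξ‖ ^ 2 := by
    intro d ξ
    rcases le_total ((2 * Real.pi * ‖ξ‖) ^ α) (1 / 8) with h | h
    · have h1 := Real.add_one_le_exp (-1 * (2 * Real.pi * ‖ξ‖) ^ α)
      have h2 : 0 ≤ K * ‖ξ‖ ^ 2 := by positivity
      rw [fracSymbol]; linarith
    · have h1 : (1 : ℝ) ≤ K * ‖ξ‖ ^ 2 := by
        have h3 := Real.rpow_le_rpow (by norm_num) h (z := 2 / α) (by positivity)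
        rw [← Real.rpow_mul (by positivity), mul_div_cancel₀ _ hα.ne', Real.rpow_two,
          Real.div_rpow (by norm_num) (by norm_num), Real.one_rpow, div_le_iff₀ (by positivity)] at h3
        rw [hK]; nlinarith
      have := Real.exp_pos (-1 * (2 * Real.pi * ‖ξ‖) ^ α)
      rw [fracSymbol]; linarith
  -- The test Gaussian has rate ε whose dual rate is b = 8Kd, so the second moment costs K d/b = 1/8
  -- and the damped mass is at least 3/4. Since εR² = 2, the part outside the ball carries at most
  -- exp (-2) ≤ 1/4.
  refine ⟨√(16 * K) / Real.pi, by positivity, fun d _ => ?_⟩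
  have hd : (1 : ℝ) ≤ d := by exact_mod_cast NeZero.one_le
  set R := √(16 * K) / Real.pi * √d with hR
  set b : ℝ := 8 * K * d with hb
  have hb0 : 0 < b := by positivity
  set ε : ℝ := Real.pi ^ 2 / b with hε
  have hε0 : 0 < ε := by positivity
  have hεR : ε * R ^ 2 = 2 := by
    rw [hR, mul_pow, div_pow, Real.sq_sqrt (by positivity), Real.sq_sqrt (by positivity), hε, hb]
    field_simp; norm_num
  have hbε : Real.pi ^ 2 / ε = b := by rw [hε]; field_simp
  have hpi := integrable_fracHeatKernel (d := d) hα hα2 one_pos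
  have hpos := fracHeatKernel_nonneg (d := d) hα hα2 one_pos
  have hmass : ∫ x : EuclideanSpace ℝ (Fin d), fracHeatKernel α 1 x ≤ 1 := by
    rw [integral_eq_lintegral_of_nonneg_ae (ae_of_all _ hpos) hpi.1]
    exact ENNReal.toReal_le_of_le_ofReal zero_le_one
      (by simpa using lintegral_fracHeatKernel_le_one hα hα2 one_pos)
  have hlow : 3 / 4 ≤ ∫ x : EuclideanSpace ℝ (Fin d),
      fracHeatKernel α 1 x * Real.exp (-ε * ‖x‖ ^ 2) := by
    rw [integral_fracHeatKernel_mul_exp hα one_pos hε0, hbε]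
    have hG := integral_gaussian_dual (d := d) hε0
    rw [hbε] at hG
    have hπ : Real.pi / ε = b / Real.pi := by rw [hε]; field_simp
    rw [hπ] at hG ⊢
    set g : EuclideanSpace ℝ (Fin d) → ℝ := fun ξ =>
      (b / Real.pi) ^ ((d : ℝ) / 2) * Real.exp (-b * ‖ξ‖ ^ 2) with hg
    have hgi : Integrable g := (integrable_exp_neg_mul_sq_norm hb0).const_mul _
    obtain ⟨hsi, hsle⟩ := integral_sq_norm_mul_exp_le (d := d) hb0
    have hsi' : Integrable fun ξ => ‖ξ‖ ^ 2 * g ξ := by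
      refine (hsi.const_mul ((b / Real.pi) ^ ((d : ℝ) / 2))).congr (ae_of_all _ fun ξ => ?_)
      simp only [hg]; ring
    have hsle' : ∫ ξ, ‖ξ‖ ^ 2 * g ξ ≤ d / b := by
      have : ∀ ξ : EuclideanSpace ℝ (Fin d), ‖ξ‖ ^ 2 * g ξ =
        (b / Real.pi) ^ ((d : ℝ) / 2) * (‖ξ‖ ^ 2 * Real.exp (-b * ‖ξ‖ ^ 2)) := fun ξ => by
          simp only [hg]; ring
      simp_rw [this]
      rw [integral_const_mul]
      refine (mul_le_mul_of_nonneg_left hsle (by positivity)).trans (le_of_eq ?_)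
      rw [mul_left_comm, ← Real.mul_rpow (by positivity) (by positivity),
        show b / Real.pi * (Real.pi / b) = 1 by field_simp, Real.one_rpow, mul_one]
    have h1 : ∫ ξ, ((1 - 1 / 8) * g ξ - K * (‖ξ‖ ^ 2 * g ξ)) ≤ ∫ ξ, fracSymbol α 1 ξ * g ξ := by
      refine integral_mono ((hgi.const_mul _).sub (hsi'.const_mul _)) ?_ fun ξ => ?_
      · refine hgi.bdd_mul (c := 1) (continuous_fracSymbol hα).aestronglyMeasurable
          (ae_of_all _ fun ξ => ?_)
        rw [fracSymbol, Real.norm_of_nonneg (Real.exp_pos _).le]; exact fracSymbol_le_one zero_le_one ξ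
      · have h2 := hsymb d ξ
        have h3 : 0 ≤ g ξ := by positivity
        simp only
        nlinarith
    rw [integral_sub (hgi.const_mul _) (hsi'.const_mul _), integral_const_mul (1 - 1 / 8 : ℝ) g,
      integral_const_mul K, hG] at h1
    have h4 : K * ∫ ξ, ‖ξ‖ ^ 2 * g ξ ≤ 1 / 8 := by
      refine (mul_le_mul_of_nonneg_left hsle' hK0.le).trans (le_of_eq ?_)
      rw [hb]; field_simp
    linarith
  have hei := integrable_fracHeatKernel_mul_exp (d := d) hα one_pos hε0
  have hsplit := integral_add_compl
    (Metric.isOpen_ball (x := (0 : EuclideanSpace ℝ (Fin d))) (ε := R)).measurableSet hei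
  have hin : ∫ x in Metric.ball (0 : EuclideanSpace ℝ (Fin d)) R,
      fracHeatKernel α 1 x * Real.exp (-ε * ‖x‖ ^ 2) ≤
      ∫ x in Metric.ball (0 : EuclideanSpace ℝ (Fin d)) R, fracHeatKernel α 1 x := by
    refine integral_mono hei.integrableOn hpi.integrableOn fun x => ?_
    refine mul_le_of_le_one_right (hpos x) (Real.exp_le_one_iff.2 ?_)
    have : 0 ≤ ε * ‖x‖ ^ 2 := by positivity
    linarith
  have hout : ∫ x in (Metric.ball (0 : EuclideanSpace ℝ (Fin d)) R)ᶜ,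
      fracHeatKernel α 1 x * Real.exp (-ε * ‖x‖ ^ 2) ≤ 1 / 4 := by
    have h1 : ∫ x in (Metric.ball (0 : EuclideanSpace ℝ (Fin d)) R)ᶜ,
        fracHeatKernel α 1 x * Real.exp (-ε * ‖x‖ ^ 2) ≤
        ∫ x in (Metric.ball (0 : EuclideanSpace ℝ (Fin d)) R)ᶜ, fracHeatKernel α 1 x * (1 / 4) := by
      refine setIntegral_mono_on hei.integrableOn (hpi.mul_const _).integrableOn
        Metric.isOpen_ball.measurableSet.compl fun x hx => ?_
      refine mul_le_mul_of_nonneg_left ?_ (hpos x)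
      have hx' : R ≤ ‖x‖ := by simpa using hx
      have hR0 : 0 ≤ R := by positivity
      have h2 : 2 ≤ ε * ‖x‖ ^ 2 := by rw [← hεR]; gcongr
      have h3 := Real.add_one_le_exp (1 : ℝ)
      have h4 : (4 : ℝ) ≤ Real.exp 2 := by
        rw [show (2 : ℝ) = 1 + 1 by norm_num, Real.exp_add]; nlinarith
      calc Real.exp (-ε * ‖x‖ ^ 2) ≤ Real.exp (-2) := Real.exp_le_exp.2 (by linarith)
        _ = (Real.exp 2)⁻¹ := Real.exp_neg 2
        _ ≤ 1 / 4 := by rw [one_div]; exact inv_anti₀ (by norm_num) h4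
    rw [integral_mul_const] at h1
    have h5 := setIntegral_le_integral (s := (Metric.ball (0 : EuclideanSpace ℝ (Fin d)) R)ᶜ) hpi
      (ae_of_all _ hpos)
    linarith
  linarith

/-! ### The semigroup on functions with values in [0, ∞]. -/

/-- The semigroup `exp (-t (-Δ)^(α/2))` acting on functions with values in `[0, ∞]`. -/
noncomputable def heatE {d : ℕ} (α t : ℝ) (f : EuclideanSpace ℝ (Fin d) → ℝ≥0∞)
    (x : EuclideanSpace ℝ (Fin d)) : ℝ≥0∞ :=
  ∫⁻ y, ENNReal.ofReal (fracHeatKernel α t (x - y)) * f y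

section HeatE

variable {d : ℕ} {α t s p : ℝ}

theorem fracHeat_eq_heatE (f : EuclideanSpace ℝ (Fin d) → ℝ) :
    fracHeat α t f = heatE α t fun y => ENNReal.ofReal (f y) := rfl

theorem heatE_mono {f g : EuclideanSpace ℝ (Fin d) → ℝ≥0∞} (h : ∀ᵐ y, f y ≤ g y)
    (x : EuclideanSpace ℝ (Fin d)) : heatE α t f x ≤ heatE α t g x :=
  lintegral_mono_ae (h.mono fun _ hy => mul_le_mul_right hy _)

theorem heatE_congr {f g : EuclideanSpace ℝ (Fin d) → ℝ≥0∞} (h : f =ᵐ[volume] g) :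
    heatE α t f = heatE α t g :=
  funext fun _ => lintegral_congr_ae (h.mono fun _ hy => by simp only [hy])

theorem measurable_kernel_comp {Y : Type*} [MeasurableSpace Y] {a : Y → ℝ}
    {b : Y → EuclideanSpace ℝ (Fin d)} (ha : Measurable a) (hb : Measurable b) :
    Measurable fun y => ENNReal.ofReal (fracHeatKernel α (a y) (b y)) := by
  have h := (measurable_fracHeatKernel (d := d) α).comp (ha.prodMk hb)
  simp only [Function.comp_def] at h
  exact h.ennreal_ofReal

theorem measurable_kernel_sub (α t : ℝ) (x : EuclideanSpace ℝ (Fin d)) :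
    Measurable fun y => ENNReal.ofReal (fracHeatKernel α t (x - y)) :=
  measurable_kernel_comp measurable_const (measurable_const.sub measurable_id)

theorem measurable_heatE_param {Y : Type*} [MeasurableSpace Y] {a : Y → ℝ}
    {b : Y → EuclideanSpace ℝ (Fin d)} {F : Y → EuclideanSpace ℝ (Fin d) → ℝ≥0∞}
    (ha : Measurable a) (hb : Measurable b) (hF : Measurable (Function.uncurry F)) :
    Measurable fun y => heatE α (a y) (F y) (b y) := by
  refine Measurable.lintegral_prod_right' (f := fun z : Y × EuclideanSpace ℝ (Fin d) =>
    ENNReal.ofReal (fracHeatKernel α (a z.1) (b z.1 - z.2)) * F z.1 z.2) ?_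
  exact Measurable.mul (measurable_kernel_comp (ha.comp measurable_fst)
    ((hb.comp measurable_fst).sub measurable_snd)) hF

theorem heatE_add (f : EuclideanSpace ℝ (Fin d) → ℝ≥0∞) {g : EuclideanSpace ℝ (Fin d) → ℝ≥0∞}
    (hg : AEMeasurable g) (x : EuclideanSpace ℝ (Fin d)) :
    heatE α t (fun y => f y + g y) x = heatE α t f x + heatE α t g x := by
  simp only [heatE, mul_add]
  exact lintegral_add_right' _ ((measurable_kernel_sub α t x).aemeasurable.mul hg)

theorem heatE_heatE [NeZero d] (hα : 0 < α) (hα2 : α ≤ 2) (ht : 0 < t) (hs : 0 < s)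
    {f : EuclideanSpace ℝ (Fin d) → ℝ≥0∞} (hf : AEMeasurable f) (x : EuclideanSpace ℝ (Fin d)) :
    heatE α t (heatE α s f) x = heatE α (t + s) f x := by
  rw [heatE_congr hf.ae_eq_mk, heatE_congr (t := t + s) hf.ae_eq_mk]
  set g := hf.mk f
  have hg : Measurable g := hf.measurable_mk
  simp only [heatE]
  have h0 : ∀ y, ENNReal.ofReal (fracHeatKernel α t (x - y)) *
      ∫⁻ z, ENNReal.ofReal (fracHeatKernel α s (y - z)) * g z =
      ∫⁻ z, ENNReal.ofReal (fracHeatKernel α t (x - y)) *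
        (ENNReal.ofReal (fracHeatKernel α s (y - z)) * g z) := fun y =>
    (lintegral_const_mul _ ((measurable_kernel_sub α s y).mul hg)).symm
  simp_rw [h0]
  rw [lintegral_lintegral_swap]
  · congr 1; ext z
    simp_rw [← mul_assoc]
    have hm : Measurable fun y => ENNReal.ofReal (fracHeatKernel α t (x - y)) *
        ENNReal.ofReal (fracHeatKernel α s (y - z)) := (measurable_kernel_sub α t x).mul
      (measurable_kernel_comp measurable_const (measurable_id.sub measurable_const))
    rw [lintegral_mul_const _ hm]
    congr 1
    rw [← lintegral_add_right_eq_self _ z]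
    simp_rw [add_sub_cancel_right]
    rw [← lintegral_fracHeatKernel_mul hα hα2 ht hs (x - z)]
    congr 1; ext y
    rw [show x - (y + z) = x - z - y by abel]
  · refine Measurable.aemeasurable ?_
    exact (measurable_kernel_comp measurable_const (measurable_const.sub measurable_fst)).mul
      ((measurable_kernel_comp measurable_const (measurable_fst.sub measurable_snd)).mul
        (hg.comp measurable_snd))

theorem heatE_lintegral {G : ℝ → EuclideanSpace ℝ (Fin d) → ℝ≥0∞}
    (hG : Measurable (Function.uncurry G)) (S : Set ℝ) (x : EuclideanSpace ℝ (Fin d)) :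
    heatE α t (fun y => ∫⁻ s in S, G s y) x = ∫⁻ s in S, heatE α t (G s) x := by
  simp only [heatE]
  have : ∀ y, Measurable fun s => G s y := fun y => hG.comp measurable_prodMk_right
  simp_rw [← lintegral_const_mul _ (this _)]
  rw [lintegral_lintegral_swap]
  refine Measurable.aemeasurable ?_
  exact (measurable_kernel_comp measurable_const (measurable_const.sub measurable_fst)).mul
    (hG.comp measurable_swap)

theorem lintegral_kernel_sub_le_one [NeZero d] (hα : 0 < α) (hα2 : α ≤ 2) (ht : 0 < t)
    (x : EuclideanSpace ℝ (Fin d)) :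
    ∫⁻ y, ENNReal.ofReal (fracHeatKernel α t (x - y)) ≤ 1 := by
  rw [lintegral_sub_left_eq_self (fun y => ENNReal.ofReal (fracHeatKernel α t y)) x]
  exact lintegral_fracHeatKernel_le_one hα hα2 ht

theorem heatE_le_const [NeZero d] (hα : 0 < α) (hα2 : α ≤ 2) (ht : 0 < t)
    {f : EuclideanSpace ℝ (Fin d) → ℝ≥0∞} {M : ℝ≥0∞} (h : ∀ᵐ y, f y ≤ M)
    (x : EuclideanSpace ℝ (Fin d)) : heatE α t f x ≤ M := by
  refine (heatE_mono h x).trans ?_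
  simp only [heatE]
  rw [lintegral_mul_const _ (measurable_kernel_sub α t x)]
  exact (mul_le_mul_left (lintegral_kernel_sub_le_one hα hα2 ht x) M).trans_eq (one_mul M)

/-- Jensen's inequality for the semigroup. -/
theorem heatE_rpow_le [NeZero d] (hα : 0 < α) (hα2 : α ≤ 2) (ht : 0 < t) (hp : 1 < p)
    {f : EuclideanSpace ℝ (Fin d) → ℝ≥0∞} (hf : Measurable f) (x : EuclideanSpace ℝ (Fin d)) :
    heatE α t f x ^ p ≤ heatE α t (fun y => f y ^ p) x := by
  set k : EuclideanSpace ℝ (Fin d) → ℝ≥0∞ := fun y => ENNReal.ofReal (fracHeatKernel α t (x - y))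
  have hk : Measurable k := measurable_kernel_sub α t x
  -- The kernel becomes the density of a measure of total mass at most 1; Jensen's inequality is
  -- then Hölder's inequality against the constant 1.
  set μ := (volume : Measure (EuclideanSpace ℝ (Fin d))).withDensity k
  have h1 : ∀ g : EuclideanSpace ℝ (Fin d) → ℝ≥0∞, Measurable g →
      heatE α t g x = ∫⁻ y, g y ∂μ := fun g hg => (lintegral_withDensity_eq_lintegral_mul _ hk hg).symm
  rw [h1 f hf, h1 _ (hf.pow_const p)]
  have hμ : μ Set.univ ≤ 1 := by
    rw [withDensity_apply _ MeasurableSet.univ, Measure.restrict_univ]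
    exact lintegral_kernel_sub_le_one hα hα2 ht x
  have hpq := Real.HolderConjugate.conjExponent hp
  have hH := ENNReal.lintegral_mul_le_Lp_mul_Lq μ hpq hf.aemeasurable
    (aemeasurable_const (b := (1 : ℝ≥0∞)))
  simp only [Pi.mul_apply, mul_one, ENNReal.one_rpow, lintegral_const, one_mul] at hH
  have hH2 : ∫⁻ y, f y ∂μ ≤ (∫⁻ y, f y ^ p ∂μ) ^ (1 / p) := by
    refine hH.trans ?_
    refine (mul_le_mul_right (ENNReal.rpow_le_one hμ ?_) _).trans_eq (mul_one _)
    exact one_div_nonneg.2 hpq.symm.pos.le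
  refine (ENNReal.rpow_le_rpow hH2 (by linarith)).trans_eq ?_
  rw [← ENNReal.rpow_mul, one_div_mul_cancel (by linarith), ENNReal.rpow_one]

end HeatE

/-! ### The a priori bound on the linear evolution. -/

/-- A superlinear integral inequality has no finite solution on a long interval. -/
theorem mul_le_one_of_superlinear {p A τ : ℝ} (hp : 1 < p) (hA : 0 < A) {g : ℝ → ℝ≥0∞}
    (hg : ∀ s, 0 < s → s < τ → (ENNReal.ofReal A + ∫⁻ r in Set.Ioo 0 s, g r) ^ p ≤ g s)
    (hfin : ∫⁻ r in Set.Ioo 0 τ, g r ≠ ∞) :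
    A ^ (p - 1) * τ * (1 - 2 ^ (1 - p)) ≤ 1 := by
  by_contra! hcon
  set q : ℝ := 2 ^ (1 - p) with hq
  have hq0 : 0 < q := by positivity
  have hq1 : q < 1 := Real.rpow_lt_one_of_one_lt_of_neg one_lt_two (by linarith)
  set a : ℝ := A ^ (1 - p) with ha
  have ha0 : 0 < a := by positivity
  have haA : a * A ^ (p - 1) = 1 := by
    rw [ha, ← Real.rpow_add hA]; simp
  -- Growth at rate at least (2^n A)^p doubles 2^n A within time (2^n A)^(1-p) = a q^n. The total
  -- a/(1-q) is below τ under the negated claim, so infinitely many doublings occur before τ.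
  set T : ℕ → ℝ := fun n => ∑ k ∈ Finset.range n, a * q ^ k with hT
  have hTle : ∀ n, T n < τ := by
    intro n
    have h1 : T n * (1 - q) ≤ a := by
      have h2 : T n * (1 - q) = a * (1 - q ^ n) := by
        simp only [hT]
        rw [← Finset.mul_sum, mul_assoc, geom_sum_mul_neg]
      rw [h2]
      have := pow_pos hq0 n
      nlinarith
    have h3 : 0 < A ^ (p - 1) := by positivity
    by_contra! h
    have h4 : τ * (1 - q) ≤ a := (mul_le_mul_of_nonneg_right h (by linarith)).trans h1
    have h5 := mul_le_mul_of_nonneg_left h4 h3.le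
    nlinarith
  have hT0 : ∀ n, 0 ≤ T n := fun n => Finset.sum_nonneg fun k _ => by positivity
  have key : ∀ n : ℕ, ∀ t, T n ≤ t → t ≤ τ →
      ENNReal.ofReal (2 ^ n * A) ≤ ENNReal.ofReal A + ∫⁻ r in Set.Ioo 0 t, g r := by
    intro n
    induction n with
    | zero => intro t _ _; simp
    | succ n ih =>
      intro t ht htτ
      have hstep : T (n + 1) = T n + a * q ^ n := by simp only [hT, Finset.sum_range_succ]
      have hpos : 0 < a * q ^ n := by positivity
      have hsub : Set.Ioc 0 (T n) ∪ Set.Ioo (T n) t ⊆ Set.Ioo 0 t := by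
        rintro r (hr | hr)
        · exact ⟨hr.1, hr.2.trans_lt (by linarith)⟩
        · exact ⟨(hT0 n).trans_lt hr.1, hr.2⟩
      have hdisj : Disjoint (Set.Ioc 0 (T n)) (Set.Ioo (T n) t) :=
        Set.disjoint_left.2 fun r h1 h2 => not_lt.2 h1.2 h2.1
      have h1 : (∫⁻ r in Set.Ioo 0 (T n), g r) + ∫⁻ r in Set.Ioo (T n) t, g r
          ≤ ∫⁻ r in Set.Ioo 0 t, g r := by
        have h0 := setLIntegral_congr (f := g)
          (Ioo_ae_eq_Ioc (μ := volume) (a := (0 : ℝ)) (b := T n))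
        have h3 := lintegral_union (μ := volume) (f := g) measurableSet_Ioo hdisj
        rw [h0, ← h3]
        exact lintegral_mono_set hsub
      have h2 : ENNReal.ofReal (2 ^ n * A) ≤ ∫⁻ r in Set.Ioo (T n) t, g r := by
        have h3 : ∀ r ∈ Set.Ioo (T n) t, ENNReal.ofReal ((2 ^ n * A) ^ p) ≤ g r := by
          intro r hr
          refine le_trans ?_ (hg r ((hT0 n).trans_lt hr.1) (hr.2.trans_le htτ))
          rw [← ENNReal.ofReal_rpow_of_nonneg (by positivity) (by linarith)]
          exact ENNReal.rpow_le_rpow (ih r hr.1.le (hr.2.le.trans htτ)) (by linarith)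
        refine le_trans ?_ (setLIntegral_mono' measurableSet_Ioo h3)
        rw [setLIntegral_const, Real.volume_Ioo, ← ENNReal.ofReal_mul (by positivity)]
        refine ENNReal.ofReal_le_ofReal ?_
        have h4 : a * q ^ n = (2 ^ n * A) ^ (1 - p) := by
          rw [Real.mul_rpow (by positivity) hA.le, ← Real.rpow_natCast, ← Real.rpow_natCast, hq, ha,
            ← Real.rpow_mul (by norm_num), ← Real.rpow_mul (by norm_num), mul_comm (n : ℝ), mul_comm]
        have h5 : (2 ^ n * A) ^ p * (2 ^ n * A) ^ (1 - p) = 2 ^ n * A := by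
          rw [← Real.rpow_add (by positivity)]; simp
        calc 2 ^ n * A = (2 ^ n * A) ^ p * (a * q ^ n) := by rw [h4, h5]
          _ ≤ _ := by gcongr; linarith
      calc ENNReal.ofReal (2 ^ (n + 1) * A)
          = ENNReal.ofReal (2 ^ n * A) + ENNReal.ofReal (2 ^ n * A) := by
            rw [← ENNReal.ofReal_add (by positivity) (by positivity)]; congr 1; ring
        _ ≤ (ENNReal.ofReal A + ∫⁻ r in Set.Ioo 0 (T n), g r) + ∫⁻ r in Set.Ioo (T n) t, g r :=
            add_le_add (ih _ le_rfl (by linarith)) h2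
        _ ≤ _ := by rw [add_assoc]; exact add_le_add le_rfl h1
  have hlt : ENNReal.ofReal A + ∫⁻ r in Set.Ioo 0 τ, g r ≠ ∞ :=
    ENNReal.add_ne_top.2 ⟨ENNReal.ofReal_ne_top, hfin⟩
  obtain ⟨n, hn⟩ := pow_unbounded_of_one_lt
    ((ENNReal.ofReal A + ∫⁻ r in Set.Ioo 0 τ, g r).toReal / A) (one_lt_two)
  have h1 := key n τ (hTle n).le le_rfl
  rw [div_lt_iff₀ hA] at hn
  exact absurd h1 (not_le.2 ((ENNReal.lt_ofReal_iff_toReal_lt hlt).2 hn))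

section Apriori

variable {d : ℕ} {α p : ℝ} {u₀ : EuclideanSpace ℝ (Fin d) → ℝ} {T : ℝ≥0∞}
  {u : ℝ → EuclideanSpace ℝ (Fin d) → ℝ}

theorem IsSolution.measurable_forcing (h : IsSolution α p u₀ T u) :
    Measurable (Function.uncurry fun s y => ENNReal.ofReal (u s y ^ p)) :=
  ENNReal.measurable_ofReal.comp (h.measurable.pow_const p)

theorem IsSolution.measurable_slice (h : IsSolution α p u₀ T u) (t : ℝ) :
    Measurable fun y => ENNReal.ofReal (u t y) :=
  ENNReal.measurable_ofReal.comp (h.measurable.comp measurable_prodMk_left)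

/-- Duhamel's formula propagated by the semigroup. -/
theorem IsSolution.heatE_sub [NeZero d] (hα : 0 < α) (hα2 : α ≤ 2) (h : IsSolution α p u₀ T u)
    (hu₀ : AEMeasurable u₀) {t τ : ℝ} (ht : 0 < t) (htT : ENNReal.ofReal t < T) (hτ : t < τ)
    (x : EuclideanSpace ℝ (Fin d)) :
    heatE α (τ - t) (fun y => ENNReal.ofReal (u t y)) x =
      heatE α τ (fun y => ENNReal.ofReal (u₀ y)) x +
        ∫⁻ s in Set.Ioo 0 t, heatE α (τ - s) (fun y => ENNReal.ofReal (u s y ^ p)) x := by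
  have hG := h.measurable_forcing
  have hm : Measurable (Function.uncurry fun s x =>
      heatE α (t - s) (fun y => ENNReal.ofReal (u s y ^ p)) x) := by
    refine measurable_heatE_param (Y := ℝ × EuclideanSpace ℝ (Fin d)) (a := fun z => t - z.1)
      (b := fun z => z.2) (F := fun z y => ENNReal.ofReal (u z.1 y ^ p))
      (measurable_const.sub measurable_fst) measurable_snd ?_
    exact hG.comp ((measurable_fst.comp measurable_fst).prodMk measurable_snd)
  rw [heatE_congr (h.duhamel t ht htT)]
  simp only [fracHeat_eq_heatE]
  have hm2 : Measurable fun x => ∫⁻ s in Set.Ioo 0 t,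
      heatE α (t - s) (fun y => ENNReal.ofReal (u s y ^ p)) x := hm.lintegral_prod_left'
  rw [heatE_add _ hm2.aemeasurable, heatE_heatE hα hα2 (by linarith) ht hu₀.ennreal_ofReal, sub_add_cancel, heatE_lintegral hm]
  congr 1
  refine setLIntegral_congr_fun measurableSet_Ioo fun s hs => ?_
  have hGs : Measurable fun y => ENNReal.ofReal (u s y ^ p) := hG.comp measurable_prodMk_left
  exact (heatE_heatE hα hα2 (by linarith) (by linarith [hs.2]) hGs.aemeasurable x).trans
    (by rw [sub_add_sub_cancel])

/-- Where Duhamel's formula holds at time τ, its right side is finite. `IsSolution.heatE_sub` and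
Jensen's inequality then give the superlinear inequality on (0, τ) at that point, with the linear
evolution as initial value A. -/
theorem IsSolution.fracHeat_le_ae [NeZero d] (hα : 0 < α) (hα2 : α ≤ 2) (hp : 1 < p)
    (h : IsSolution α p u₀ T u)
    (hu₀ : AEMeasurable u₀) {τ : ℝ} (hτ : 0 < τ) (hτT : ENNReal.ofReal τ < T) :
    ∀ᵐ x, fracHeat α τ u₀ x ≤
      ENNReal.ofReal ((1 - 2 ^ (1 - p)) ^ (-(1 / (p - 1))) * τ ^ (-(1 / (p - 1)))) := by
  filter_upwards [h.duhamel τ hτ hτT] with x hx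
  have hfin : fracHeat α τ u₀ x +
    ∫⁻ s in Set.Ioo 0 τ, fracHeat α (τ - s) (fun y => u s y ^ p) x ≠ ∞ := by
    rw [← hx]; exact ENNReal.ofReal_ne_top
  obtain ⟨hfin1, hfin2⟩ := ENNReal.add_ne_top.1 hfin
  set A := (fracHeat α τ u₀ x).toReal with hA
  have hAe : fracHeat α τ u₀ x = ENNReal.ofReal A := (ENNReal.ofReal_toReal hfin1).symm
  rw [hAe]
  refine ENNReal.ofReal_le_ofReal ?_
  have hq1 : (2 : ℝ) ^ (1 - p) < 1 := Real.rpow_lt_one_of_one_lt_of_neg one_lt_two (by linarith)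
  have hq : (0 : ℝ) < 1 - 2 ^ (1 - p) := by linarith
  have hA0 : 0 ≤ A := ENNReal.toReal_nonneg
  clear_value A
  rcases hA0.eq_or_lt with h0 | h0
  · rw [← h0]; positivity
  have key := mul_le_one_of_superlinear hp h0 (τ := τ) ?_ hfin2
  · have h1 : A ^ (p - 1) ≤ ((1 - 2 ^ (1 - p)) * τ)⁻¹ := by
      rw [← one_div, le_div_iff₀ (by positivity)]; linarith
    have h2 := Real.rpow_le_rpow (by positivity) h1 (z := 1 / (p - 1))
      (one_div_nonneg.2 (by linarith))
    rw [← Real.rpow_mul h0.le, mul_one_div_cancel (by linarith), Real.rpow_one,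
      Real.inv_rpow (by positivity), ← Real.rpow_neg (by positivity),
      Real.mul_rpow hq.le hτ.le] at h2
    exact h2
  · intro s hs hsτ
    have hsT : ENNReal.ofReal s < T := (ENNReal.ofReal_le_ofReal hsτ.le).trans_lt hτT
    have h1 := h.heatE_sub hα hα2 hu₀ hs hsT hsτ x
    rw [← hAe]
    simp only [fracHeat_eq_heatE]
    rw [← h1]
    refine (heatE_rpow_le hα hα2 (by linarith) hp (h.measurable_slice s) x).trans_eq ?_
    congr 1; ext y
    rw [ENNReal.ofReal_rpow_of_nonneg (h.nonneg s hs hsT y) (by linarith)]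

/-- A set of full measure is dense, and the linear evolution is lower semicontinuous in x by Fatou's
lemma. This allows evaluation at the origin. -/
theorem fracHeat_le_of_ae_le [NeZero d] (hα : 0 < α) (hu₀ : AEMeasurable u₀) {τ : ℝ} (hτ : 0 < τ)
    {c : ℝ≥0∞} (h : ∀ᵐ x, fracHeat α τ u₀ x ≤ c) (x : EuclideanSpace ℝ (Fin d)) :
    fracHeat α τ u₀ x ≤ c := by
  have hd : Dense {x : EuclideanSpace ℝ (Fin d) | fracHeat α τ u₀ x ≤ c} :=
    Measure.dense_of_ae h
  obtain ⟨v, hv, hvx⟩ := mem_closure_iff_seq_limit.1 (hd x)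
  have hcont := continuous_fracHeatKernel (d := d) hα hτ
  have hpt : ∀ y, Tendsto (fun n => ENNReal.ofReal (fracHeatKernel α τ (v n - y)) *
      ENNReal.ofReal (u₀ y)) atTop (𝓝 (ENNReal.ofReal (fracHeatKernel α τ (x - y)) *
      ENNReal.ofReal (u₀ y))) := fun y =>
    ENNReal.Tendsto.mul_const (ENNReal.tendsto_ofReal
      ((hcont.tendsto _).comp (hvx.sub_const y))) (Or.inr ENNReal.ofReal_ne_top)
  calc fracHeat α τ u₀ x = ∫⁻ y, liminf (fun n => ENNReal.ofReal (fracHeatKernel α τ (v n - y)) *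
      ENNReal.ofReal (u₀ y)) atTop := by
        rw [fracHeat]; congr 1; ext y; exact (hpt y).liminf_eq.symm
    _ ≤ liminf (fun n => fracHeat α τ u₀ (v n)) atTop :=
        lintegral_liminf_le' fun n =>
          (measurable_kernel_sub α τ (v n)).aemeasurable.mul hu₀.ennreal_ofReal
    _ ≤ c := (liminf_le_liminf (Eventually.of_forall hv)).trans_eq (by simp)

/-- A priori bound on the linear evolution of the initial datum of a solution. -/
theorem IsSolution.fracHeat_le [NeZero d] (hα : 0 < α) (hα2 : α ≤ 2) (hp : 1 < p)
    (h : IsSolution α p u₀ T u)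
    (hu₀ : AEMeasurable u₀) {τ : ℝ} (hτ : 0 < τ) (hτT : ENNReal.ofReal τ < T)
    (x : EuclideanSpace ℝ (Fin d)) :
    fracHeat α τ u₀ x ≤
      ENNReal.ofReal ((1 - 2 ^ (1 - p)) ^ (-(1 / (p - 1))) * τ ^ (-(1 / (p - 1)))) :=
  fracHeat_le_of_ae_le hα hu₀ hτ (h.fracHeat_le_ae hα hα2 hp hu₀ hτ hτT) x

end Apriori

/-! ### Local solvability and continuation of bounded solutions. -/

section Picard

variable {d : ℕ} {α p : ℝ}

/-- The Duhamel map with inhomogeneity `F` and initial time `a`. -/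
noncomputable def duhamelMap (α p a : ℝ) (F w : ℝ → EuclideanSpace ℝ (Fin d) → ℝ≥0∞) (t : ℝ)
    (x : EuclideanSpace ℝ (Fin d)) : ℝ≥0∞ :=
  F t x + ∫⁻ s in Set.Ioo a t, heatE α (t - s) (fun y => w s y ^ p) x

theorem measurable_setLIntegral_heatE {c : ℝ → ℝ} (hc : Measurable c) (a : ℝ)
    {G : ℝ → EuclideanSpace ℝ (Fin d) → ℝ≥0∞}
    (hG : Measurable (Function.uncurry G)) :
    Measurable fun z : ℝ × EuclideanSpace ℝ (Fin d) =>
      ∫⁻ s in Set.Ioo a (c z.1), heatE α (z.1 - s) (G s) z.2 := by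
  simp_rw [← lintegral_indicator measurableSet_Ioo]
  refine Measurable.lintegral_prod_right' (f := fun q : (ℝ × EuclideanSpace ℝ (Fin d)) × ℝ =>
    (Set.Ioo a (c q.1.1)).indicator (fun s => heatE α (q.1.1 - s) (G s) q.1.2) q.2) ?_
  simp only [Set.indicator_apply]
  refine Measurable.ite ?_ ?_ measurable_const
  · exact (measurableSet_lt measurable_const measurable_snd).inter
      (measurableSet_lt measurable_snd (hc.comp (measurable_fst.comp measurable_fst)))
  · refine measurable_heatE_param (Y := (ℝ × EuclideanSpace ℝ (Fin d)) × ℝ)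
      (a := fun q => q.1.1 - q.2) (b := fun q => q.1.2) (F := fun q y => G q.2 y)
      ((measurable_fst.comp measurable_fst).sub measurable_snd)
      (measurable_snd.comp measurable_fst) ?_
    exact hG.comp ((measurable_snd.comp measurable_fst).prodMk measurable_snd)

theorem measurable_duhamelMap {a : ℝ} {F w : ℝ → EuclideanSpace ℝ (Fin d) → ℝ≥0∞}
    (hF : Measurable (Function.uncurry F)) (hw : Measurable (Function.uncurry w)) :
    Measurable (Function.uncurry (duhamelMap α p a F w)) :=
  hF.add (measurable_setLIntegral_heatE measurable_id a (G := fun s y => w s y ^ p)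
    (hw.pow_const p))

theorem duhamelMap_mono (hp : 0 ≤ p) {a : ℝ} {F w w' : ℝ → EuclideanSpace ℝ (Fin d) → ℝ≥0∞}
    (h : w ≤ w') : duhamelMap α p a F w ≤ duhamelMap α p a F w' := fun _ x =>
  add_le_add le_rfl (lintegral_mono fun s => heatE_mono
    (ae_of_all _ fun y => ENNReal.rpow_le_rpow (h s y) hp) x)

/-- Solvability of the Duhamel equation with a bounded inhomogeneity on a short interval. -/
theorem exists_duhamelMap_eq [NeZero d] (hα : 0 < α) (hα2 : α ≤ 2) (hp : 1 < p) {a τ B : ℝ}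
    (hB : 0 < B) (hτ : τ * (2 * B) ^ p ≤ B)
    {F : ℝ → EuclideanSpace ℝ (Fin d) → ℝ≥0∞} (hF : Measurable (Function.uncurry F))
    (hFB : ∀ t, a ≤ t → ∀ x, F t x ≤ ENNReal.ofReal B) :
    ∃ w : ℝ → EuclideanSpace ℝ (Fin d) → ℝ≥0∞, Measurable (Function.uncurry w) ∧
      (∀ t, a ≤ t → t ≤ a + τ → ∀ x, w t x ≤ ENNReal.ofReal (2 * B)) ∧
      w = duhamelMap α p a F w := by
  -- Iteration from zero is increasing, so monotone convergence makes the supremum a fixed point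
  -- without any contraction estimate. The condition on τ keeps the iterates below B + τ(2B)^p ≤ 2B.
  set W : ℕ → ℝ → EuclideanSpace ℝ (Fin d) → ℝ≥0∞ := fun n => (duhamelMap α p a F)^[n] 0 with hW
  have hW0 : W 0 = 0 := rfl
  have hWs : ∀ n, W (n + 1) = duhamelMap α p a F (W n) := fun n =>
    Function.iterate_succ_apply' _ _ _
  have hmono : Monotone W := by
    refine monotone_nat_of_le_succ fun n => ?_
    induction n with
    | zero => rw [hW0]; exact fun _ _ => zero_le
    | succ n ih => rw [hWs, hWs (n + 1)]; exact duhamelMap_mono (by linarith) ih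
  have hmeas : ∀ n, Measurable (Function.uncurry (W n)) := by
    intro n
    induction n with
    | zero => rw [hW0]; exact measurable_const
    | succ n ih => rw [hWs]; exact measurable_duhamelMap hF ih
  have hbd : ∀ n t, a ≤ t → t ≤ a + τ → ∀ x, W n t x ≤ ENNReal.ofReal (2 * B) := by
    intro n
    induction n with
    | zero => intro _ _ _ x; rw [hW0]; exact zero_le
    | succ n ih =>
      intro t hat htτ x
      rw [hWs, duhamelMap]
      have h1 : ∀ s ∈ Set.Ioo a t, heatE α (t - s) (fun y => W n s y ^ p) x ≤
          ENNReal.ofReal ((2 * B) ^ p) := by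
        intro s hs
        refine heatE_le_const hα hα2 (by linarith [hs.2]) (ae_of_all _ fun y => ?_) x
        rw [← ENNReal.ofReal_rpow_of_nonneg (by positivity) (by linarith)]
        exact ENNReal.rpow_le_rpow (ih s hs.1.le (hs.2.le.trans htτ) y) (by linarith)
      have h2 : ∫⁻ s in Set.Ioo a t, heatE α (t - s) (fun y => W n s y ^ p) x ≤
          ENNReal.ofReal B := by
        refine (setLIntegral_mono' measurableSet_Ioo h1).trans ?_
        rw [setLIntegral_const, Real.volume_Ioo, ← ENNReal.ofReal_mul (by positivity)]
        refine ENNReal.ofReal_le_ofReal (le_trans ?_ hτ)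
        rw [mul_comm]
        gcongr
        linarith
      refine (add_le_add (hFB t hat x) h2).trans_eq ?_
      rw [← ENNReal.ofReal_add hB.le hB.le, two_mul]
  refine ⟨fun t x => ⨆ n, W n t x, ?_, fun t h1 h2 x => iSup_le fun n => hbd n t h1 h2 x, ?_⟩
  · have := Measurable.iSup hmeas
    exact this
  · funext t x
    have hshift : ⨆ n, W n t x = ⨆ n, W (n + 1) t x :=
      (Monotone.iSup_nat_add (fun m n hmn => hmono hmn t x) 1).symm
    simp only [hshift, hWs, duhamelMap]
    rw [← ENNReal.add_iSup]
    congr 1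
    have hsl : ∀ n s, Measurable fun y => W n s y ^ p := fun n s =>
      ((hmeas n).comp measurable_prodMk_left).pow_const p
    have h1 : ∀ s, heatE α (t - s) (fun y => (⨆ n, W n s y) ^ p) x =
        ⨆ n, heatE α (t - s) (fun y => W n s y ^ p) x := by
      intro s
      simp only [heatE]
      refine (lintegral_congr fun y => ?_).trans (lintegral_iSup (f := fun n y =>
        ENNReal.ofReal (fracHeatKernel α (t - s) (x - y)) * W n s y ^ p)
        (fun n => (measurable_kernel_sub α (t - s) x).mul (hsl n s)) fun m n hmn y =>
        mul_le_mul_right (ENNReal.rpow_le_rpow (hmono hmn s y) (by linarith)) _)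
      rw [← ENNReal.mul_iSup]
      congr 1
      exact (ENNReal.orderIsoRpow p (by linarith)).map_iSup _
    simp_rw [h1]
    rw [lintegral_iSup]
    · intro n
      refine measurable_heatE_param (a := fun s => t - s) (b := fun _ => x)
        (F := fun s y => W n s y ^ p) (measurable_const.sub measurable_id) measurable_const
        ((hmeas n).pow_const p)
    · intro m n hmn s
      exact heatE_mono (ae_of_all _ fun y => ENNReal.rpow_le_rpow (hmono hmn s y) (by linarith)) x

end Picard

/-- A solution which stays bounded up to a finite time can be continued. -/
theorem IsSolution.exists_extension {d : ℕ} [NeZero d] {α p : ℝ}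
    {u₀ : EuclideanSpace ℝ (Fin d) → ℝ} {T : ℝ≥0∞} {u : ℝ → EuclideanSpace ℝ (Fin d) → ℝ}
    (hα : 0 < α) (hα2 : α ≤ 2) (hp : 1 < p) (h : IsSolution α p u₀ T u) (hu₀ : AEMeasurable u₀)
    (hT : T ≠ ∞)
    (hlim : limsup (fun t => eLpNorm (u t) ∞ volume) (𝓝[<] T.toReal) ≠ ∞) :
    ∃ (T' : ℝ≥0∞) (v : ℝ → EuclideanSpace ℝ (Fin d) → ℝ), T < T' ∧ IsSolution α p u₀ T' v ∧
      ∀ t : ℝ, 0 < t → ENNReal.ofReal t < T → v t = u t := by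
  set b := T.toReal with hb
  have hTb : T = ENNReal.ofReal b := (ENNReal.ofReal_toReal hT).symm
  have hb0 : 0 < b := ENNReal.toReal_pos h.pos.ne' hT
  have hlt : ∀ t, ENNReal.ofReal t < T ↔ t < b := fun t => by
    rw [hTb]; exact ENNReal.ofReal_lt_ofReal_iff hb0
  obtain ⟨M, hM1, hM2⟩ := ENNReal.lt_iff_exists_nnreal_btwn.1 (lt_top_iff_ne_top.2 hlim)
  have hev := eventually_lt_of_limsup_lt hM1
  obtain ⟨l, hl, hlM⟩ := (mem_nhdsLT_iff_exists_Ioo_subset' hb0).1 hev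
  have hlb : l < b := hl
  set c := (max l 0 + b) / 2 with hc
  have hm : max l 0 < b := max_lt hlb hb0
  -- The time c lies in the left neighbourhood of b on which M bounds the solution.
  have hcb : c < b := by rw [hc]; linarith
  have hlc : l < c := by rw [hc]; linarith [le_max_left l 0]
  have hc0 : 0 < c := by rw [hc]; linarith [le_max_right l 0]
  have hbd : ∀ s, c ≤ s → s < b → ∀ᵐ y, ENNReal.ofReal (u s y) ≤ (M : ℝ≥0∞) := by
    intro s hcs hsb
    have h1 : eLpNorm (u s) ∞ volume < M := hlM ⟨hlc.trans_le hcs, hsb⟩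
    rw [eLpNorm_exponent_top] at h1
    filter_upwards [ae_le_eLpNormEssSup (f := u s) (μ := volume)] with y hy
    refine le_trans ?_ (hy.trans h1.le)
    rw [Real.enorm_eq_ofReal_abs]
    exact ENNReal.ofReal_le_ofReal (le_abs_self _)
  have hG := h.measurable_forcing
  have hu₀' : AEMeasurable fun y => ENNReal.ofReal (u₀ y) := hu₀.ennreal_ofReal
  -- For t ≥ b, F collects the datum and all the forcing before b; the continuation solves the
  -- Duhamel equation from b with F as inhomogeneity.
  set F : ℝ → EuclideanSpace ℝ (Fin d) → ℝ≥0∞ := fun t x =>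
    heatE α t (fun y => ENNReal.ofReal (u₀ y)) x +
      ∫⁻ s in Set.Ioo 0 b, heatE α (t - s) (fun y => ENNReal.ofReal (u s y ^ p)) x with hF
  have hFm : Measurable (Function.uncurry F) := by
    refine Measurable.add ?_ (measurable_setLIntegral_heatE (c := fun _ => b) measurable_const 0 hG)
    rw [show (fun z : ℝ × EuclideanSpace ℝ (Fin d) =>
        heatE α z.1 (fun y => ENNReal.ofReal (u₀ y)) z.2) = fun z => heatE α z.1 (hu₀'.mk _) z.2 from
      funext fun z => congrFun (heatE_congr hu₀'.ae_eq_mk) z.2]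
    exact measurable_heatE_param (a := fun z : ℝ × EuclideanSpace ℝ (Fin d) => z.1)
      (b := fun z => z.2) (F := fun _ => hu₀'.mk _) measurable_fst measurable_snd
      (hu₀'.measurable_mk.comp measurable_snd)
  set B : ℝ := M + b * (M : ℝ) ^ p + 1 with hB
  have hB0 : 0 < B := by positivity
  -- The datum may be unbounded. Restarting at c turns it, together with the forcing before c, into
  -- the evolution of u(c), which is at most M; the forcing on [c, b) adds at most b M^p.
  have hFB : ∀ t, b ≤ t → ∀ x, F t x ≤ ENNReal.ofReal B := by
    intro t hbt x
    have hsplit : ∫⁻ s in Set.Ioo 0 b, heatE α (t - s) (fun y => ENNReal.ofReal (u s y ^ p)) x =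
        (∫⁻ s in Set.Ioo 0 c, heatE α (t - s) (fun y => ENNReal.ofReal (u s y ^ p)) x) +
        ∫⁻ s in Set.Ico c b, heatE α (t - s) (fun y => ENNReal.ofReal (u s y ^ p)) x := by
      rw [← Set.Ioo_union_Ico_eq_Ioo hc0 hcb.le]
      exact lintegral_union measurableSet_Ico
        (Set.disjoint_left.2 fun r h1 h2 => not_lt.2 h2.1 h1.2)
    have h1 := h.heatE_sub hα hα2 hu₀ hc0 ((hlt c).2 hcb) (hcb.trans_le hbt) x
    have h2 : ∀ s ∈ Set.Ico c b, heatE α (t - s) (fun y => ENNReal.ofReal (u s y ^ p)) x ≤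
        ENNReal.ofReal ((M : ℝ) ^ p) := by
      intro s hs
      refine heatE_le_const hα hα2 (by linarith [hs.2]) ?_ x
      filter_upwards [hbd s hs.1 hs.2] with y hy
      have h0 := h.nonneg s (hc0.trans_le hs.1) ((hlt s).2 hs.2) y
      refine ENNReal.ofReal_le_ofReal (Real.rpow_le_rpow h0 ?_ (by linarith))
      rw [← ENNReal.ofReal_coe_nnreal] at hy
      exact (ENNReal.ofReal_le_ofReal_iff M.coe_nonneg).1 hy
    have h3 : ∫⁻ s in Set.Ico c b, heatE α (t - s) (fun y => ENNReal.ofReal (u s y ^ p)) x ≤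
        ENNReal.ofReal (b * (M : ℝ) ^ p) := by
      refine (setLIntegral_mono' measurableSet_Ico h2).trans ?_
      rw [setLIntegral_const, Real.volume_Ico, ← ENNReal.ofReal_mul (by positivity)]
      refine ENNReal.ofReal_le_ofReal ?_
      rw [mul_comm]
      gcongr
      linarith
    have h4 := heatE_le_const hα hα2 (by linarith : 0 < t - c) (hbd c le_rfl hcb) x
    simp only [hF]
    rw [hsplit, ← add_assoc, ← h1]
    refine (add_le_add h4 h3).trans ?_
    rw [← ENNReal.ofReal_coe_nnreal, ← ENNReal.ofReal_add M.coe_nonneg (by positivity)]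
    exact ENNReal.ofReal_le_ofReal (by linarith)
  set τ : ℝ := B / (2 * B) ^ p with hτ
  have hτ0 : 0 < τ := by positivity
  obtain ⟨w, hwm, hwB, hweq⟩ := exists_duhamelMap_eq hα hα2 hp hB0
    (τ := τ) (div_mul_cancel₀ _ (by positivity)).le hFm hFB
  refine ⟨ENNReal.ofReal (b + τ), fun t x => if t < b then u t x else (w t x).toReal, ?_, ?_, ?_⟩
  · rw [hTb]
    exact (ENNReal.ofReal_lt_ofReal_iff (by linarith)).2 (by linarith)
  · refine ⟨ENNReal.ofReal_pos.2 (by linarith), ?_, ?_, ?_⟩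
    · exact Measurable.ite (measurableSet_lt measurable_fst measurable_const) h.measurable
        hwm.ennreal_toReal
    · intro t ht _ x
      split_ifs with htb
      · exact h.nonneg t ht ((hlt t).2 htb) x
      · exact ENNReal.toReal_nonneg
    · intro t ht htT'
      have htτ : t < b + τ := (ENNReal.ofReal_lt_ofReal_iff (by linarith)).1 htT'
      have hbefore : ∀ s, s < b → (fun y => (if s < b then u s y else (w s y).toReal) ^ p) =
          fun y => u s y ^ p := fun s hs => by simp only [hs, if_true]
      by_cases htb : t < b
      · filter_upwards [h.duhamel t ht ((hlt t).2 htb)] with x hx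
        simp only [htb, if_true]
        rw [hx]
        congr 1
        refine setLIntegral_congr_fun measurableSet_Ioo fun s hs => ?_
        rw [hbefore s (hs.2.trans htb)]
      · refine ae_of_all _ fun x => ?_
        simp only [htb, if_false]
        rw [not_lt] at htb
        rw [ENNReal.ofReal_toReal
          ((hwB t htb htτ.le x).trans_lt ENNReal.ofReal_lt_top).ne]
        rw [show w t x = duhamelMap α p b F w t x from congrFun (congrFun hweq t) x, duhamelMap, hF,
          add_assoc, fracHeat_eq_heatE, ← Set.Ioo_union_Ico_eq_Ioo hb0 htb,
          lintegral_union measurableSet_Ico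
            (Set.disjoint_left.2 fun r h1 h2 => not_lt.2 h2.1 h1.2)]
        congr 2
        · refine setLIntegral_congr_fun measurableSet_Ioo fun s hs => ?_
          rw [hbefore s hs.2, fracHeat_eq_heatE]
        · rw [← setLIntegral_congr (Ioo_ae_eq_Ico (μ := volume) (a := b) (b := t))]
          refine setLIntegral_congr_fun measurableSet_Ioo fun s hs => ?_
          rw [fracHeat_eq_heatE]
          congr 1
          ext y
          simp only [not_lt.2 hs.1.le, if_false]
          rw [← ENNReal.ofReal_rpow_of_nonneg ENNReal.toReal_nonneg (by linarith),
            ENNReal.ofReal_toReal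
              ((hwB s hs.1.le (by linarith [hs.2]) y).trans_lt ENNReal.ofReal_lt_top).ne]
  · intro t _ htT
    funext x
    simp only [(hlt t).1 htT, if_true]

/-- If the linear evolution of the datum violates the a priori bound at some time, then each
solution blows up in a finite time. -/
theorem eachSolutionBlowsUp_of_lt {d : ℕ} [NeZero d] {α p : ℝ}
    {u₀ : EuclideanSpace ℝ (Fin d) → ℝ}
    (hα : 0 < α) (hα2 : α ≤ 2) (hp : 1 < p) (hu₀ : AEMeasurable u₀) {τ : ℝ} (hτ : 0 < τ)
    (hlt : ENNReal.ofReal ((1 - 2 ^ (1 - p)) ^ (-(1 / (p - 1))) * τ ^ (-(1 / (p - 1)))) <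
      fracHeat α τ u₀ 0) : EachSolutionBlowsUp α p u₀ := by
  intro T u hu
  have hT : T ≠ ∞ := by
    rintro rfl
    exact absurd (hu.1.fracHeat_le hα hα2 hp hu₀ hτ ENNReal.ofReal_lt_top 0) (not_le.2 hlt)
  refine ⟨lt_top_iff_ne_top.2 hT, ?_⟩
  by_contra hlim
  obtain ⟨T', v, hTT', hv, huv⟩ := hu.1.exists_extension hα hα2 hp hu₀ hT hlim
  exact hu.2 T' v hTT' hv fun t h1 h2 => by rw [huv t h1 h2]

/-! ### Gamma function estimates. -/

section Gamma

/-- Log-convexity of Γ at x + 1 = h(x + h) + (1 - h)(x + h + 1). -/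
theorem mul_Gamma_le_Gamma_add {x h : ℝ} (hx : 0 < x) (h0 : 0 < h) (h1 : h ≤ 1) :
    x * Real.Gamma x ≤ Real.Gamma (x + h) * (x + h) ^ (1 - h) := by
  rw [← Real.Gamma_add_one hx.ne']
  rcases h1.eq_or_lt with rfl | h1
  · simp
  have hG : 0 < Real.Gamma (x + h) := Real.Gamma_pos_of_pos (by linarith)
  have := Real.Gamma_mul_add_mul_le_rpow_Gamma_mul_rpow_Gamma (s := x + h) (t := x + h + 1)
    (by linarith) (by linarith) h0 (by linarith : 0 < 1 - h) (by ring)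
  rw [show h * (x + h) + (1 - h) * (x + h + 1) = x + 1 by ring,
    Real.Gamma_add_one (by linarith : x + h ≠ 0), Real.mul_rpow (by linarith) hG.le, mul_left_comm,
    ← Real.rpow_add hG, add_sub_cancel, Real.rpow_one, mul_comm] at this
  exact this

/-- Log-convexity leaves a factor x/(x + h), which is increasing in x and hence at least δ/(δ + h).
-/
theorem Gamma_add_div_Gamma_ge {x h δ : ℝ} (hδ : 0 < δ) (hx : δ ≤ x) (h0 : 0 < h) (h1 : h ≤ 1) :
    δ / (δ + h) * (x + h) ^ h ≤ Real.Gamma (x + h) / Real.Gamma x := by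
  have hx0 : 0 < x := hδ.trans_le hx
  have hG := Real.Gamma_pos_of_pos hx0
  rw [le_div_iff₀ hG]
  have key := mul_Gamma_le_Gamma_add hx0 h0 h1
  have h3 : 0 < (x + h) ^ (1 - h) := by positivity
  refine le_of_mul_le_mul_right ?_ h3
  refine le_trans ?_ key
  have h4 : (x + h) ^ h * (x + h) ^ (1 - h) = x + h := by
    rw [← Real.rpow_add (by positivity)]; simp
  calc δ / (δ + h) * (x + h) ^ h * Real.Gamma x * (x + h) ^ (1 - h)
      = δ / (δ + h) * ((x + h) ^ h * (x + h) ^ (1 - h)) * Real.Gamma x := by ring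
    _ = δ / (δ + h) * (x + h) * Real.Gamma x := by rw [h4]
    _ ≤ x * Real.Gamma x := by
        refine mul_le_mul_of_nonneg_right ?_ hG.le
        rw [div_mul_eq_mul_div, div_le_iff₀ (by positivity)]
        nlinarith

/-- A Stirling upper bound by induction in steps x → x + 1 from Γ(1/2) and Γ(1). The step amounts to
e ≤ (1 + 1/x)^(x + 1/2), which is log(1 + y) ≥ 2y/(y + 2) at y = 1/x. -/
theorem Gamma_half_nat_le (n : ℕ) :
    Real.Gamma (((n : ℝ) + 1) / 2) ≤ 4 * ((((n : ℝ) + 1) / 2) ^ (((n : ℝ) + 1) / 2 - 1 / 2) *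
      Real.exp (-(((n : ℝ) + 1) / 2))) := by
  induction n using Nat.twoStepInduction with
  | zero =>
    have h1 : √Real.pi ≤ 2 := Real.sqrt_le_iff.2 ⟨by norm_num, by linarith [Real.pi_le_four]⟩
    have h2 := Real.add_one_le_exp (-(1 / 2 : ℝ))
    norm_num [Real.Gamma_one_half_eq] at h2 ⊢
    linarith
  | one =>
    have h2 : Real.exp (1 : ℝ) ≤ 4 := by linarith [Real.exp_one_lt_d9]
    norm_num
    rw [Real.exp_neg, ← div_eq_mul_inv, le_div_iff₀ (Real.exp_pos _)]
    linarith
  | more n ih _ =>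
    push_cast
    set x : ℝ := ((n : ℝ) + 1) / 2 with hx
    have hx0 : 0 < x := by positivity
    rw [show ((n : ℝ) + 2 + 1) / 2 = x + 1 by rw [hx]; ring, Real.Gamma_add_one hx0.ne']
    have hlog := Real.le_log_one_add_of_nonneg (x := 1 / x) (by positivity)
    have hlog2 : 1 ≤ (x + 1 / 2) * Real.log (1 + 1 / x) := by
      refine le_trans (le_of_eq ?_) (mul_le_mul_of_nonneg_left hlog (by positivity))
      field_simp
      ring
    have hpow : Real.exp 1 ≤ (1 + 1 / x) ^ (x + 1 / 2) := by
      rw [Real.rpow_def_of_pos (by positivity), mul_comm]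
      exact Real.exp_le_exp.2 hlog2
    have h3 : x ^ (x + 1 / 2) * Real.exp 1 ≤ (x + 1) ^ (x + 1 / 2) := by
      have : (x + 1) ^ (x + 1 / 2) = x ^ (x + 1 / 2) * (1 + 1 / x) ^ (x + 1 / 2) := by
        rw [← Real.mul_rpow hx0.le (by positivity)]; congr 1; field_simp
      rw [this]
      gcongr
    calc x * Real.Gamma x ≤ x * (4 * (x ^ (x - 1 / 2) * Real.exp (-x))) := by gcongr
      _ = 4 * (x ^ (x + 1 / 2) * Real.exp (-x)) := by
          rw [show x + 1 / 2 = 1 + (x - 1 / 2) by ring, Real.rpow_add hx0, Real.rpow_one]; ring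
      _ = 4 * (x ^ (x + 1 / 2) * Real.exp 1 * Real.exp (-(x + 1))) := by
          rw [mul_assoc (x ^ (x + 1 / 2)), ← Real.exp_add]; ring_nf
      _ ≤ 4 * ((x + 1) ^ (x + 1 / 2) * Real.exp (-(x + 1))) := by gcongr
      _ = _ := by ring_nf

theorem sphereArea_pos {d : ℕ} (hd : 1 ≤ d) : 0 < sphereArea d := by
  have : (0 : ℝ) < d := by exact_mod_cast hd
  have := Real.Gamma_pos_of_pos (by positivity : (0 : ℝ) < (d : ℝ) / 2)
  rw [sphereArea]
  positivity

/-- Stirling's lower bound for the area of the unit sphere. -/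
theorem rpow_le_sphereArea {d : ℕ} (hd : 1 ≤ d) :
    (2 * Real.pi * Real.exp 1 / d) ^ ((d : ℝ) / 2) ≤
      4 * (sphereArea d * (d : ℝ) ^ (-(1 / 2 : ℝ))) := by
  obtain ⟨n, rfl⟩ := Nat.exists_eq_add_of_le' hd
  have h := Gamma_half_nat_le n
  have hd' : ((n + 1 : ℕ) : ℝ) = (n : ℝ) + 1 := by push_cast; rfl
  rw [← hd'] at h
  set d : ℕ := n + 1
  have hd0 : (0 : ℝ) < d := by exact_mod_cast hd
  have hG := Real.Gamma_pos_of_pos (by positivity : (0 : ℝ) < (d : ℝ) / 2)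
  rw [sphereArea]
  set x : ℝ := (d : ℝ) / 2 with hx
  have hx0 : 0 < x := by positivity
  have hdx : (d : ℝ) = 2 * x := by rw [hx]; ring
  have e1 : (2 * Real.pi * Real.exp 1 / d) ^ x = Real.pi ^ x * Real.exp x / x ^ x := by
    rw [hdx, show 2 * Real.pi * Real.exp 1 / (2 * x) = Real.pi * Real.exp 1 / x by
      field_simp, Real.div_rpow (by positivity) hx0.le, Real.mul_rpow (by positivity)
      (by positivity), Real.exp_one_rpow]
  have e2 : (d : ℝ) ^ (-(1 / 2 : ℝ)) = 2 ^ (-(1 / 2 : ℝ)) * x ^ (-(1 / 2 : ℝ)) := by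
    rw [hdx, Real.mul_rpow (by norm_num) hx0.le]
  have e3 : (1 / 2 : ℝ) ≤ 2 ^ (-(1 / 2 : ℝ)) := by
    rw [show (1 / 2 : ℝ) = 2 ^ (-1 : ℝ) by rw [Real.rpow_neg_one]; norm_num]
    exact Real.rpow_le_rpow_of_exponent_le (by norm_num) (by norm_num)
  rw [e1, e2]
  have e4 : x ^ (x - 1 / 2) = x ^ x * x ^ (-(1 / 2 : ℝ)) := by
    rw [← Real.rpow_add hx0]; ring_nf
  rw [e4, Real.exp_neg] at h
  have hxx : 0 < x ^ x := by positivity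
  have hxh : 0 < x ^ (-(1 / 2 : ℝ)) := by positivity
  calc Real.pi ^ x * Real.exp x / x ^ x
      = Real.pi ^ x * x ^ (-(1 / 2 : ℝ)) / (x ^ x * x ^ (-(1 / 2 : ℝ)) * (Real.exp x)⁻¹) := by
        field_simp
    _ ≤ Real.pi ^ x * x ^ (-(1 / 2 : ℝ)) / (Real.Gamma x / 4) := by
        gcongr
        linarith
    _ = 4 * (2 * Real.pi ^ x / Real.Gamma x * (1 / 2 * x ^ (-(1 / 2 : ℝ)))) := by
        field_simp
    _ ≤ _ := by gcongr

end Gamma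

/-! ### From the size of the datum to its linear evolution. -/

section Bounds

variable {d : ℕ} {α p : ℝ} {u₀ : EuclideanSpace ℝ (Fin d) → ℝ}

/-- On the ball of radius |x| the radially decreasing kernel is at least its value at x. -/
theorem ofReal_kernel_mul_le_fracHeat [NeZero d] (hα : 0 < α) (hα2 : α ≤ 2) {τ : ℝ} (hτ : 0 < τ)
    (x : EuclideanSpace ℝ (Fin d)) :
    ENNReal.ofReal (fracHeatKernel α τ x) * ∫⁻ y in Metric.ball 0 ‖x‖, ENNReal.ofReal (u₀ y) ≤
      fracHeat α τ u₀ 0 := by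
  rw [← lintegral_const_mul' _ _ ENNReal.ofReal_ne_top]
  refine le_trans (setLIntegral_mono' Metric.isOpen_ball.measurableSet fun y hy => ?_)
    (setLIntegral_le_lintegral _ _)
  gcongr
  refine fracHeatKernel_anti hα hα2 hτ ?_
  rw [zero_sub, norm_neg]
  exact (mem_ball_zero_iff.1 hy).le

theorem sphereArea_eq [NeZero d] :
    (d : ℝ) * (volume : Measure (EuclideanSpace ℝ (Fin d))).real (Metric.ball 0 1) =
      sphereArea d := by
  have hd0 : (0 : ℝ) < d := by exact_mod_cast NeZero.pos d
  have hG := Real.Gamma_pos_of_pos (by positivity : (0 : ℝ) < (d : ℝ) / 2)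
  rw [measureReal_def, EuclideanSpace.volume_ball, Fintype.card_fin, ENNReal.ofReal_one, one_pow,
    one_mul, Real.Gamma_add_one (by positivity), ENNReal.toReal_ofReal (by positivity), sphereArea,
    Real.sqrt_eq_rpow, ← Real.rpow_natCast, ← Real.rpow_mul Real.pi_pos.le,
    show (1 / 2 : ℝ) * d = d / 2 by ring]
  field_simp

/-- Mass of the kernel in a ball, in polar coordinates. -/
theorem integral_ball_fracHeatKernel [NeZero d] (hα : 0 < α) (hα2 : α ≤ 2)
    {e : EuclideanSpace ℝ (Fin d)} (he : ‖e‖ = 1) (R : ℝ) :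
    IntegrableOn (fun ρ : ℝ => ρ ^ (d - 1) * fracHeatKernel α 1 (ρ • e)) (Set.Ioo 0 R) ∧
    ∫ x in Metric.ball (0 : EuclideanSpace ℝ (Fin d)) R, fracHeatKernel α 1 x =
      sphereArea d * ∫ ρ in Set.Ioo 0 R, ρ ^ (d - 1) * fracHeatKernel α 1 (ρ • e) := by
  have hrad : ∀ x : EuclideanSpace ℝ (Fin d),
      fracHeatKernel α 1 (‖x‖ • e) = fracHeatKernel α 1 x := fun x =>
    fracHeatKernel_congr_norm hα hα2 one_pos (by rw [norm_smul, he]; simp)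
  constructor
  · have h := (integrableOn_fun_norm_addHaar (E := EuclideanSpace ℝ (Fin d)) volume
      (f := fun ρ => fracHeatKernel α 1 (ρ • e)) (r := R)).1 ?_
    · simpa using h
    · simp_rw [hrad]
      exact (integrable_fracHeatKernel hα hα2 one_pos).integrableOn
  · have h := integral_fun_norm_addHaar (E := EuclideanSpace ℝ (Fin d)) volume
      (fun ρ => (Set.Iio R).indicator (fun ρ => fracHeatKernel α 1 (ρ • e)) ρ)
    rw [finrank_euclideanSpace, Fintype.card_fin, nsmul_eq_mul, smul_eq_mul, ← mul_assoc,
      sphereArea_eq] at h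
    have h1 : ∫ x : EuclideanSpace ℝ (Fin d),
        (Set.Iio R).indicator (fun ρ => fracHeatKernel α 1 (ρ • e)) ‖x‖ =
        ∫ x in Metric.ball (0 : EuclideanSpace ℝ (Fin d)) R, fracHeatKernel α 1 x := by
      rw [← integral_indicator Metric.isOpen_ball.measurableSet]
      congr 1; ext x
      by_cases hx : x ∈ Metric.ball (0 : EuclideanSpace ℝ (Fin d)) R
      · rw [Set.indicator_of_mem hx, Set.indicator_of_mem (Set.mem_Iio.2 (mem_ball_zero_iff.1 hx)),
          hrad]
      · rw [Set.indicator_of_notMem hx,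
          Set.indicator_of_notMem fun h' => hx (mem_ball_zero_iff.2 (Set.mem_Iio.1 h'))]
    rw [← h1, h]
    congr 1
    rw [show Set.Ioo (0 : ℝ) R = Set.Ioi 0 ∩ Set.Iio R from rfl,
      ← setIntegral_indicator measurableSet_Iio]
    congr 1; ext ρ
    by_cases hρ : ρ ∈ Set.Iio R <;> simp [hρ]

/-- Bound of the radial concentration by the decay of the linear evolution, any `α ∈ (0, 2]`. -/
theorem concentration_le_of_decay [NeZero d] (hα : 0 < α) (hα2 : α ≤ 2) (hp : 1 < p) {R K : ℝ}
    (hR : 0 < R) (hK : 0 < K)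
    (hmass : 1 / 2 ≤ ∫ x in Metric.ball (0 : EuclideanSpace ℝ (Fin d)) R, fracHeatKernel α 1 x)
    (hdecay : ∀ τ : ℝ, 0 < τ → fracHeat α τ u₀ 0 ≤ ENNReal.ofReal (K * τ ^ (-(1 / (p - 1)))))
    {r : ℝ} (hr : 0 < r) :
    ENNReal.ofReal (r ^ (α / (p - 1) - (d : ℝ))) *
      ∫⁻ y in Metric.ball 0 r, ENNReal.ofReal (u₀ y) ≤
      ENNReal.ofReal (2 * sphereArea d * (K * (R ^ (α / (p - 1)) / (α / (p - 1))))) := by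
  set m := ∫⁻ y in Metric.ball 0 r, ENNReal.ofReal (u₀ y) with hm
  set γ : ℝ := α / (p - 1) with hγ
  have hγ0 : 0 < γ := div_pos hα (by linarith)
  have hd1 : 1 ≤ d := NeZero.one_le
  have hσ := sphereArea_pos hd1
  set e : EuclideanSpace ℝ (Fin d) := EuclideanSpace.single 0 1 with he
  have he1 : ‖e‖ = 1 := by simp [he]
  obtain ⟨hint, hpolar⟩ := integral_ball_fracHeatKernel hα hα2 he1 R
  have hq0 : ∀ ρ : ℝ, 0 ≤ fracHeatKernel α 1 (ρ • e) := fun ρ =>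
    fracHeatKernel_nonneg hα hα2 one_pos _
  -- At τ = (r/ρ)^α, scaling turns the kernel at distance r into the time-one kernel at distance ρ.
  -- Division by ρ then produces the polar density ρ^(d-1) P₁(ρe) on the left and ρ^(γ-1) on the
  -- right, to be integrated over (0, R).
  have hpt : ∀ ρ ∈ Set.Ioo 0 R, ENNReal.ofReal (ρ ^ (d - 1) * fracHeatKernel α 1 (ρ • e)) *
      (ENNReal.ofReal ((r ^ d)⁻¹) * m) ≤ ENNReal.ofReal (K * r ^ (-γ) * ρ ^ (γ - 1)) := by
    intro ρ hρ
    have hρ0 : 0 < ρ := hρ.1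
    have hc : 0 < r / ρ := by positivity
    have h1 := hdecay ((r / ρ) ^ α) (by positivity)
    have h2 := ofReal_kernel_mul_le_fracHeat (u₀ := u₀) hα hα2
      (by positivity : 0 < (r / ρ) ^ α) ((r / ρ) • ρ • e)
    rw [fracHeatKernel_rpow_smul hα hc, norm_smul, norm_smul, he1, Real.norm_of_nonneg hc.le,
      Real.norm_of_nonneg hρ0.le, mul_one, div_mul_cancel₀ _ hρ0.ne', ← hm] at h2
    have h3 := h2.trans h1
    have e1 : ((r / ρ) ^ α) ^ (-(1 / (p - 1))) = r ^ (-γ) * ρ ^ γ := by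
      rw [← Real.rpow_mul hc.le, show α * -(1 / (p - 1)) = -γ by rw [hγ]; ring,
        Real.div_rpow hr.le hρ0.le, Real.rpow_neg hρ0.le γ, div_inv_eq_mul]
    rw [e1] at h3
    have h4 := mul_le_mul_right h3 (ENNReal.ofReal ρ⁻¹)
    rw [← mul_assoc, ← ENNReal.ofReal_mul (by positivity), ← ENNReal.ofReal_mul (by positivity)] at h4
    rw [← mul_assoc, ← ENNReal.ofReal_mul (mul_nonneg (by positivity) (hq0 ρ))]
    refine le_trans (le_of_eq ?_) (h4.trans (le_of_eq ?_))
    · congr 2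
      have : ρ ^ d = ρ ^ (d - 1) * ρ := by rw [← pow_succ, Nat.sub_add_cancel hd1]
      rw [div_pow, this]
      field_simp
    · congr 1
      rw [Real.rpow_sub hρ0, Real.rpow_one]; field_simp
  have hI1 : ENNReal.ofReal (1 / (2 * sphereArea d)) ≤
      ∫⁻ ρ in Set.Ioo 0 R, ENNReal.ofReal (ρ ^ (d - 1) * fracHeatKernel α 1 (ρ • e)) := by
    rw [← ofReal_integral_eq_lintegral_ofReal hint]
    · refine ENNReal.ofReal_le_ofReal ?_
      rw [hpolar] at hmass
      rw [div_le_iff₀ (by positivity)]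
      linarith
    · exact (ae_restrict_mem measurableSet_Ioo).mono fun ρ hρ =>
        mul_nonneg (pow_nonneg hρ.1.le _) (hq0 ρ)
  have hI2 : ∫⁻ ρ in Set.Ioo 0 R, ENNReal.ofReal (K * r ^ (-γ) * ρ ^ (γ - 1)) =
      ENNReal.ofReal (K * r ^ (-γ) * (R ^ γ / γ)) := by
    have hii : IntervalIntegrable (fun ρ : ℝ => ρ ^ (γ - 1)) volume 0 R :=
      intervalIntegral.intervalIntegrable_rpow' (by linarith)
    rw [← ofReal_integral_eq_lintegral_ofReal]
    · rw [integral_const_mul, ← integral_Ioc_eq_integral_Ioo,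
        ← intervalIntegral.integral_of_le hR.le, integral_rpow (Or.inl (by linarith)),
        sub_add_cancel, Real.zero_rpow hγ0.ne', sub_zero]
    · exact ((hii.1.mono_set Set.Ioo_subset_Ioc_self).const_mul _)
    · exact (ae_restrict_mem measurableSet_Ioo).mono fun ρ hρ => by
        have := hρ.1
        positivity
  have hmul : ENNReal.ofReal (1 / (2 * sphereArea d)) * (ENNReal.ofReal ((r ^ d)⁻¹) * m) ≤
      ENNReal.ofReal (K * r ^ (-γ) * (R ^ γ / γ)) := by
    refine (mul_le_mul_left hI1 _).trans ?_
    rw [← hI2]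
    exact (lintegral_mul_const_le _ _).trans (setLIntegral_mono' measurableSet_Ioo hpt)
  have h5 := mul_le_mul_right hmul (ENNReal.ofReal (2 * sphereArea d * r ^ γ))
  rw [← mul_assoc, ← mul_assoc, ← ENNReal.ofReal_mul (by positivity),
    ← ENNReal.ofReal_mul (by positivity), ← ENNReal.ofReal_mul (by positivity)] at h5
  refine le_trans (le_of_eq ?_) (h5.trans (le_of_eq ?_))
  · congr 2
    rw [Real.rpow_sub hr, Real.rpow_natCast]
    field_simp
  · congr 1
    rw [Real.rpow_neg hr.le]
    have : r ^ γ ≠ 0 := by positivity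
    field_simp

/-- Bound of the radial concentration by the decay of the linear evolution, sharper for `α = 2`. -/
theorem concentration_le_of_decay_two [NeZero d] {K : ℝ} (hK : 0 < K)
    (hdecay : ∀ τ : ℝ, 0 < τ → fracHeat 2 τ u₀ 0 ≤ ENNReal.ofReal (K * τ ^ (-(1 / (p - 1)))))
    {r : ℝ} (hr : 0 < r) :
    ENNReal.ofReal (r ^ (2 / (p - 1) - (d : ℝ))) *
      ∫⁻ y in Metric.ball 0 r, ENNReal.ofReal (u₀ y) ≤
      ENNReal.ofReal (4 * K * 2 ^ (1 / (p - 1)) *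
        (sphereArea d * (d : ℝ) ^ (1 / (p - 1) - 1 / 2))) := by
  set m := ∫⁻ y in Metric.ball 0 r, ENNReal.ofReal (u₀ y) with hm
  have hd1 : 1 ≤ d := NeZero.one_le
  have hd0 : (0 : ℝ) < d := by exact_mod_cast hd1
  set g : ℝ := 1 / (p - 1) with hg
  have hg2 : 2 / (p - 1) = 2 * g := by rw [hg]; ring
  set e : EuclideanSpace ℝ (Fin d) := EuclideanSpace.single 0 1 with he
  have he1 : ‖r • e‖ = r := by rw [norm_smul, Real.norm_of_nonneg hr.le]; simp [he]
  -- This time maximizes the Gaussian kernel at distance r; the maximum is r^(-d) Q⁻¹, with Q below.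
  have hτ : 0 < r ^ 2 / (2 * d) := by positivity
  have h1 := (ofReal_kernel_mul_le_fracHeat (u₀ := u₀) two_pos le_rfl hτ (r • e)).trans
    (hdecay _ hτ)
  rw [he1, ← hm, fracHeatKernel_two hτ, he1] at h1
  set Q : ℝ := (2 * Real.pi * Real.exp 1 / d) ^ ((d : ℝ) / 2) with hQ
  have hQ0 : 0 < Q := by positivity
  have e1 : (4 * Real.pi * (r ^ 2 / (2 * d))) ^ (-((d : ℝ) / 2)) *
      Real.exp (-(r ^ 2 / (4 * (r ^ 2 / (2 * d))))) = r ^ (-(d : ℝ)) * Q⁻¹ := by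
    have a1 : Real.exp (-(r ^ 2 / (4 * (r ^ 2 / (2 * d))))) = (Real.exp 1 ^ ((d : ℝ) / 2))⁻¹ := by
      rw [Real.exp_one_rpow, ← Real.exp_neg]; congr 1; field_simp; norm_num
    have a2 : r ^ (-(d : ℝ)) = ((r ^ 2) ^ ((d : ℝ) / 2))⁻¹ := by
      rw [← Real.rpow_natCast r 2, ← Real.rpow_mul hr.le, ← Real.rpow_neg hr.le]
      congr 1; push_cast; ring
    rw [a1, a2, Real.rpow_neg (by positivity), ← mul_inv, ← mul_inv,
      ← Real.mul_rpow (by positivity) (by positivity), hQ,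
      ← Real.mul_rpow (by positivity) (by positivity)]
    congr 2
    field_simp
    norm_num
  have e2 : (r ^ 2 / (2 * d)) ^ (-g) = r ^ (-(2 * g)) * (2 ^ g * (d : ℝ) ^ g) := by
    rw [Real.div_rpow (by positivity) (by positivity), ← Real.rpow_natCast r 2,
      ← Real.rpow_mul hr.le, Real.rpow_neg (by positivity), div_inv_eq_mul,
      Real.mul_rpow (by norm_num) hd0.le]
    congr 2; push_cast; ring
  rw [e1, e2] at h1
  have h2 := mul_le_mul_right h1 (ENNReal.ofReal (r ^ (2 * g) * Q))
  rw [← mul_assoc, ← ENNReal.ofReal_mul (by positivity), ← ENNReal.ofReal_mul (by positivity)] at h2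
  refine le_trans (le_of_eq ?_) (h2.trans (ENNReal.ofReal_le_ofReal ?_))
  · congr 2
    rw [hg2, Real.rpow_sub hr, Real.rpow_neg hr.le]
    field_simp
  -- Stirling's formula bounds Q by a multiple of σ_d d^(-1/2), the source of the exponent -1/2.
  · have hS := rpow_le_sphereArea hd1
    rw [← hQ] at hS
    have hr2 : r ^ (2 * g) * r ^ (-(2 * g)) = 1 := by rw [← Real.rpow_add hr]; simp
    calc r ^ (2 * g) * Q * (K * (r ^ (-(2 * g)) * (2 ^ g * (d : ℝ) ^ g)))
        = (r ^ (2 * g) * r ^ (-(2 * g))) * (K * (2 ^ g * (d : ℝ) ^ g) * Q) := by ring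
      _ = K * (2 ^ g * (d : ℝ) ^ g) * Q := by rw [hr2, one_mul]
      _ ≤ K * (2 ^ g * (d : ℝ) ^ g) * (4 * (sphereArea d * (d : ℝ) ^ (-(1 / 2 : ℝ)))) := by
          gcongr
      _ = _ := by
          rw [sub_eq_add_neg g, Real.rpow_add hd0]; ring

/-- Blowup by a large radial concentration. -/
theorem eachSolutionBlowsUp_of_concentration [NeZero d] (hα : 0 < α) (hα2 : α ≤ 2) (hp : 1 < p)
    (hu₀ : AEMeasurable u₀) {c : ℝ≥0∞}
    (hle : (∀ τ : ℝ, 0 < τ → fracHeat α τ u₀ 0 ≤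
      ENNReal.ofReal ((1 - 2 ^ (1 - p)) ^ (-(1 / (p - 1))) * τ ^ (-(1 / (p - 1))))) →
      ∀ r : ℝ, 0 < r → ENNReal.ofReal (r ^ (α / (p - 1) - (d : ℝ))) *
        ∫⁻ y in Metric.ball 0 r, ENNReal.ofReal (u₀ y) ≤ c)
    (hlt : c < radialConcentration α p u₀) : EachSolutionBlowsUp α p u₀ := by
  by_cases hdecay : ∀ τ : ℝ, 0 < τ → fracHeat α τ u₀ 0 ≤
      ENNReal.ofReal ((1 - 2 ^ (1 - p)) ^ (-(1 / (p - 1))) * τ ^ (-(1 / (p - 1))))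
  · exact absurd (iSup₂_le (hle hdecay)) (not_le.2 hlt)
  · push Not at hdecay
    obtain ⟨τ, hτ, h⟩ := hdecay
    exact eachSolutionBlowsUp_of_lt hα hα2 hp hu₀ hτ h

/-- Lower bound for the constant of the singular solution, uniform in the dimension. -/
theorem exists_singularConst_ge (hα : 0 < α) (hα2 : α ≤ 2) (hp : 1 < p) :
    ∃ c : ℝ, 0 < c ∧ ∀ d : ℕ, p * α / (p - 1) < d →
      c * (d : ℝ) ^ (α / (p - 1) / 2) ≤ singularConst α d p := by
  have hp1 : 0 < p - 1 := by linarith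
  set K : ℝ := p * α / (p - 1) with hK
  have hK0 : 0 < K := by positivity
  set γ : ℝ := α / (p - 1) with hγ
  have hγ0 : 0 < γ := by positivity
  have hKγ : K = γ + α := by rw [hK, hγ]; field_simp; ring
  -- The quotient Γ(x + h)/Γ(x) degenerates as x = (d - K)/2 tends to 0. Since d is an integer above
  -- K, it is at least ⌊K⌋ + 1, which keeps x ≥ δ uniformly in d.
  set δ : ℝ := ((⌊K⌋₊ : ℝ) + 1 - K) / 2 with hδ
  have hδ0 : 0 < δ := by have := Nat.lt_floor_add_one K; rw [hδ]; linarith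
  set h : ℝ := α / 2 with hh
  have hh0 : 0 < h := by positivity
  have hG1 : 0 < Real.Gamma (α / (2 * (p - 1))) := Real.Gamma_pos_of_pos (by positivity)
  have hG2 : 0 < Real.Gamma (p * α / (2 * (p - 1))) := Real.Gamma_pos_of_pos (by positivity)
  -- L gives d = 2(x + h) + γ ≤ L(x + h), because x + h ≥ h.
  set L : ℝ := 2 * (1 + γ / 2 / h) with hL
  have hL0 : 0 < L := by positivity
  set c₁ : ℝ := 2 ^ α / Real.Gamma (α / (2 * (p - 1))) * Real.Gamma (p * α / (2 * (p - 1))) *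
    (δ / (δ + h) * (L ^ h)⁻¹) with hc₁
  have hc₁0 : 0 < c₁ := by positivity
  refine ⟨c₁ ^ (1 / (p - 1)), by positivity, fun d hd => ?_⟩
  have hd0 : (0 : ℝ) < d := hK0.trans hd
  have hfl : (⌊K⌋₊ : ℝ) + 1 ≤ d := by
    exact_mod_cast (Nat.floor_lt hK0.le).2 hd
  set x : ℝ := (d : ℝ) / 2 - K / 2 with hx
  have hxδ : δ ≤ x := by rw [hx, hδ]; linarith
  have a1 : (d : ℝ) / 2 - p * α / (2 * (p - 1)) = x := by rw [hx, hK]; field_simp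
  have a2 : (d : ℝ) / 2 - α / (2 * (p - 1)) = x + h := by
    rw [hx, hKγ, hh, show α / (2 * (p - 1)) = γ / 2 by rw [hγ]; field_simp]; ring
  have hGam := Gamma_add_div_Gamma_ge hδ0 hxδ hh0 (by rw [hh]; linarith)
  have hxh : (d : ℝ) / L ≤ x + h := by
    have hx0 : 0 < x := hδ0.trans_le hxδ
    have : (d : ℝ) = 2 * (x + h) + γ := by rw [hx, hKγ, hh]; ring
    rw [div_le_iff₀ hL0, this, hL]
    have h3 : γ ≤ (x + h) * (γ / h) := by
      rw [← mul_div_assoc, le_div_iff₀ hh0]; nlinarith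
    calc 2 * (x + h) + γ ≤ 2 * (x + h) + (x + h) * (γ / h) := by linarith
      _ = _ := by field_simp
  have hbase : c₁ * (d : ℝ) ^ h ≤ 2 ^ α / Real.Gamma (α / (2 * (p - 1))) *
      (Real.Gamma (x + h) * Real.Gamma (p * α / (2 * (p - 1))) / Real.Gamma x) := by
    have h4 : (L ^ h)⁻¹ * (d : ℝ) ^ h ≤ (x + h) ^ h := by
      rw [← Real.inv_rpow hL0.le, ← Real.mul_rpow (by positivity) hd0.le, inv_mul_eq_div]
      exact Real.rpow_le_rpow (by positivity) hxh hh0.le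
    calc c₁ * (d : ℝ) ^ h = 2 ^ α / Real.Gamma (α / (2 * (p - 1))) *
          Real.Gamma (p * α / (2 * (p - 1))) * (δ / (δ + h) * ((L ^ h)⁻¹ * (d : ℝ) ^ h)) := by
          rw [hc₁]; ring
      _ ≤ 2 ^ α / Real.Gamma (α / (2 * (p - 1))) *
          Real.Gamma (p * α / (2 * (p - 1))) * (δ / (δ + h) * (x + h) ^ h) := by gcongr
      _ ≤ 2 ^ α / Real.Gamma (α / (2 * (p - 1))) *
          Real.Gamma (p * α / (2 * (p - 1))) * (Real.Gamma (x + h) / Real.Gamma x) := by gcongr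
      _ = _ := by ring
  rw [singularConst, a1, a2]
  refine le_trans (le_of_eq ?_) (Real.rpow_le_rpow (by positivity) hbase (by positivity))
  rw [Real.mul_rpow hc₁0.le (by positivity), ← Real.rpow_mul hd0.le]
  congr 2
  rw [hγ, hh]; field_simp

/-- Blowup for data above a large multiple of the singular solution. -/
theorem eachSolutionBlowsUp_of_singularSol_le [NeZero d] (hα : 0 < α) (hα2 : α ≤ 2) (hp : 1 < p)
    (hu₀ : AEMeasurable u₀) {N R : ℝ} (hN : 0 ≤ N) (hs : 0 ≤ singularConst α d p) (hR : 0 < R)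
    (hmass : 1 / 2 ≤ ∫ x in Metric.ball (0 : EuclideanSpace ℝ (Fin d)) R, fracHeatKernel α 1 x)
    (hle : ∀ᵐ x, N * singularSol α p x ≤ u₀ x)
    (hlt : (1 - 2 ^ (1 - p)) ^ (-(1 / (p - 1))) <
      N * (singularConst α d p * R ^ (-(α / (p - 1)))) * (1 / 2)) :
    EachSolutionBlowsUp α p u₀ := by
  refine eachSolutionBlowsUp_of_lt hα hα2 hp hu₀ one_pos ?_
  rw [Real.one_rpow, mul_one]
  set c : ℝ := N * (singularConst α d p * R ^ (-(α / (p - 1)))) with hc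
  have hc0 : 0 ≤ c := by positivity
  have hq : (0 : ℝ) ≤ 1 - 2 ^ (1 - p) := by
    have : (2 : ℝ) ^ (1 - p) < 1 := Real.rpow_lt_one_of_one_lt_of_neg one_lt_two (by linarith)
    linarith
  have hγ : 0 ≤ α / (p - 1) := div_nonneg hα.le (by linarith)
  calc ENNReal.ofReal ((1 - 2 ^ (1 - p)) ^ (-(1 / (p - 1)))) < ENNReal.ofReal (c * (1 / 2)) :=
        (ENNReal.ofReal_lt_ofReal_iff (lt_of_le_of_lt (by positivity) hlt)).2 hlt
    _ = ENNReal.ofReal (1 / 2) * ENNReal.ofReal c := by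
        rw [mul_comm, ENNReal.ofReal_mul (by norm_num)]
    _ ≤ (∫⁻ y in Metric.ball (0 : EuclideanSpace ℝ (Fin d)) R,
          ENNReal.ofReal (fracHeatKernel α 1 y)) * ENNReal.ofReal c := by
        refine mul_le_mul_left ?_ _
        rw [← ofReal_integral_eq_lintegral_ofReal
          (integrable_fracHeatKernel hα hα2 one_pos).integrableOn
          (ae_of_all _ (fracHeatKernel_nonneg hα hα2 one_pos))]
        exact ENNReal.ofReal_le_ofReal hmass
    _ ≤ ∫⁻ y in Metric.ball (0 : EuclideanSpace ℝ (Fin d)) R,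
          ENNReal.ofReal (fracHeatKernel α 1 (0 - y)) * ENNReal.ofReal (u₀ y) := by
        refine (lintegral_mul_const_le _ _).trans (lintegral_mono_ae ?_)
        -- The lower bound on u_∞ in the ball may fail at the origin, where the real power takes the
        -- value 0.
        have h0 : ∀ᵐ y : EuclideanSpace ℝ (Fin d), y ≠ 0 := Measure.ae_ne volume 0
        filter_upwards [ae_restrict_of_ae hle, ae_restrict_of_ae h0,
          ae_restrict_mem Metric.isOpen_ball.measurableSet] with y hy hy0 hyR
        rw [fracHeatKernel_congr_norm hα hα2 one_pos (x := 0 - y) (y := y) (by simp)]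
        refine mul_le_mul_right (ENNReal.ofReal_le_ofReal (le_trans ?_ hy)) _
        have hny : 0 < ‖y‖ := norm_pos_iff.2 hy0
        have := Real.rpow_le_rpow_of_nonpos hny (mem_ball_zero_iff.1 hyR).le
          (neg_nonpos.2 hγ)
        rw [hc, singularSol]
        gcongr
    _ ≤ fracHeat α 1 u₀ 0 := setLIntegral_le_lintegral _ _

end Bounds

/-! ### Choice of the dimension-free constants. -/

theorem theorem3p1 :
    -- (i)
    (∀ α p : ℝ, 0 < α → α ≤ 2 → 1 < p → ∃ ν : ℝ, ∀ d : ℕ, α < d → 1 + α / ((d : ℝ) - α) < p →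
      ∀ N : ℝ, ν < N → ∀ u₀ : EuclideanSpace ℝ (Fin d) → ℝ, AEMeasurable u₀ volume →
        (∀ x, 0 ≤ u₀ x) → (∀ᵐ x, N * singularSol α p x ≤ u₀ x) →
        EachSolutionBlowsUp α p u₀) ∧
    -- (ii)
    (∀ p : ℝ, 1 < p → ∃ κ₀ : ℝ, ∀ d : ℕ, 1 ≤ d → 1 + 2 / (d : ℝ) < p →
      ∀ κ : ℝ, κ₀ < κ → ∀ u₀ : EuclideanSpace ℝ (Fin d) → ℝ, AEMeasurable u₀ volume →
        (∀ x, 0 ≤ u₀ x) →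
        ENNReal.ofReal (κ * sphereArea d * (d : ℝ) ^ (1 / (p - 1) - 1 / 2)) ≤
          radialConcentration 2 p u₀ →
        EachSolutionBlowsUp 2 p u₀) ∧
    -- (iii)
    (∀ α p : ℝ, 0 < α → α < 2 → 1 < p → ∃ κ₀ : ℝ, ∀ d : ℕ, 1 ≤ d → 1 + α / (d : ℝ) < p →
      ∀ κ : ℝ, κ₀ < κ → ∀ u₀ : EuclideanSpace ℝ (Fin d) → ℝ, AEMeasurable u₀ volume →
        (∀ x, 0 ≤ u₀ x) →
        ENNReal.ofReal (κ * sphereArea d * (d : ℝ) ^ (α / (2 * (p - 1)))) ≤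
          radialConcentration α p u₀ →
        EachSolutionBlowsUp α p u₀) := by
  have hpos : ∀ p : ℝ, 1 < p → 0 < (1 - 2 ^ (1 - p) : ℝ) ^ (-(1 / (p - 1))) := fun p hp => by
    have : (2 : ℝ) ^ (1 - p) < 1 := Real.rpow_lt_one_of_one_lt_of_neg one_lt_two (by linarith)
    exact Real.rpow_pos_of_pos (by linarith) _
  have hsqrt : ∀ {C γ : ℝ} (d : ℕ), 0 < C →
      (C * √(d : ℝ)) ^ γ = C ^ γ * (d : ℝ) ^ (γ / 2) := fun d hC => by
    rw [Real.mul_rpow hC.le (by positivity), Real.sqrt_eq_rpow, ← Real.rpow_mul (by positivity)]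
    ring_nf
  refine ⟨fun α p hα hα2 hp => ?_, fun p hp => ?_, fun α p hα hα2 hp => ?_⟩
  · obtain ⟨C, hC, hmass⟩ := exists_half_le_integral_ball hα hα2
    obtain ⟨c, hc, hsing⟩ := exists_singularConst_ge hα hα2 hp
    have hK := hpos p hp
    set K : ℝ := (1 - 2 ^ (1 - p)) ^ (-(1 / (p - 1))) with hKdef
    refine ⟨2 * K * (C ^ (α / (p - 1)) / c), fun d hd hdp N hN u₀ hu₀ _ hle => ?_⟩
    have hd0 : (0 : ℝ) < d := hα.trans hd
    have : NeZero d := ⟨by rintro rfl; simp at hd0⟩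
    have hN0 : 0 < N := lt_trans (by positivity) hN
    have hp1 : 0 < p - 1 := by linarith
    -- The supercriticality condition rewritten as positivity of the smallest Gamma argument in
    -- s(α,d,p).
    have hdK : p * α / (p - 1) < d := by
      have hda : 0 < (d : ℝ) - α := by linarith
      have h1 : α / ((d : ℝ) - α) < p - 1 := by linarith
      rw [div_lt_iff₀ hda] at h1
      rw [div_lt_iff₀ hp1]
      linarith
    have hs := hsing d hdK
    have hR : 0 < C * √(d : ℝ) := by positivity
    refine eachSolutionBlowsUp_of_singularSol_le hα hα2 hp hu₀ hN0.le
      (le_trans (by positivity) hs) hR (hmass d) hle ?_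
    rw [Real.rpow_neg hR.le, hsqrt d hC, ← hKdef]
    have hdγ : 0 < (d : ℝ) ^ (α / (p - 1) / 2) := by positivity
    have hCγ : 0 < C ^ (α / (p - 1)) := by positivity
    -- The factor d^(γ/2) from the singular constant cancels the one from the radius C√d.
    calc K = 2 * K * (C ^ (α / (p - 1)) / c) * (c / C ^ (α / (p - 1))) * (1 / 2) := by field_simp
      _ < N * (c / C ^ (α / (p - 1))) * (1 / 2) := by gcongr
      _ = N * (c * (d : ℝ) ^ (α / (p - 1) / 2) *
          (C ^ (α / (p - 1)) * (d : ℝ) ^ (α / (p - 1) / 2))⁻¹) * (1 / 2) := by field_simp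
      _ ≤ _ := by gcongr
  · have hK := hpos p hp
    refine ⟨4 * (1 - 2 ^ (1 - p)) ^ (-(1 / (p - 1))) * 2 ^ (1 / (p - 1)),
      fun d hd _ κ hκ u₀ hu₀ _ hle => ?_⟩
    have : NeZero d := ⟨by omega⟩
    have hd0 : (0 : ℝ) < d := by exact_mod_cast hd
    have hσ := sphereArea_pos hd
    have hκ0 : 0 < κ := lt_trans (by positivity) hκ
    refine eachSolutionBlowsUp_of_concentration two_pos le_rfl hp hu₀
      (fun hdecay r hr => concentration_le_of_decay_two hK hdecay hr) (lt_of_lt_of_le ?_ hle)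
    rw [mul_assoc κ]
    refine (ENNReal.ofReal_lt_ofReal_iff (by positivity)).2 ?_
    gcongr
  · obtain ⟨C, hC, hmass⟩ := exists_half_le_integral_ball hα hα2.le
    have hK := hpos p hp
    have hγ : 0 < α / (p - 1) := div_pos hα (by linarith)
    refine ⟨2 * ((1 - 2 ^ (1 - p)) ^ (-(1 / (p - 1))) * (C ^ (α / (p - 1)) / (α / (p - 1)))),
      fun d hd _ κ hκ u₀ hu₀ _ hle => ?_⟩
    have : NeZero d := ⟨by omega⟩
    have hd0 : (0 : ℝ) < d := by exact_mod_cast hd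
    have hσ := sphereArea_pos hd
    have hκ0 : 0 < κ := lt_trans (by positivity) hκ
    refine eachSolutionBlowsUp_of_concentration hα hα2.le hp hu₀
      (fun hdecay r hr => concentration_le_of_decay hα hα2.le hp (R := C * √(d : ℝ))
        (by positivity) hK (hmass d) hdecay hr) (lt_of_lt_of_le ?_ hle)
    refine (ENNReal.ofReal_lt_ofReal_iff (by positivity)).2 ?_
    rw [hsqrt d hC, show α / (p - 1) / 2 = α / (2 * (p - 1)) by field_simp]
    set K : ℝ := (1 - 2 ^ (1 - p)) ^ (-(1 / (p - 1)))
    calc 2 * sphereArea d * (K * (C ^ (α / (p - 1)) * (d : ℝ) ^ (α / (2 * (p - 1))) / (α / (p - 1))))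
        = 2 * (K * (C ^ (α / (p - 1)) / (α / (p - 1)))) * sphereArea d *
          (d : ℝ) ^ (α / (2 * (p - 1))) := by ring
      _ < _ := by gcongr
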